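/- **Setting.** A profile consists of three curves $\Gamma_i=(r_i(\alpha),z_i(\alpha))$, $\alpha\in[0,1]$, $i=1,2,3$, in the meridian half plane; each is of class $C^4$ on $[0,1]$, satisfies $r_{i\alpha}r_{i\alpha\alpha}+z_{i\alpha}z_{i\alpha\alpha}=0$ and is injective. Let $\theta_i\in C([0,1];(-\pi,\pi])$ be the angle from the positive $r$-axis to the unit tangent, so $(\cos\theta_i,\sin\theta_i)=(r_{i\alpha},z_{i\alpha})/\sqrt{r_{i\alpha}^2+z_{i\alpha}^2}$, and let $$H_i=\frac{r_{i\alpha}z_{i\alpha\alpha}-z_{i\alpha}r_{i\alpha\alpha}}{2(r_{i\alpha}^2+z_{i\alpha}^2)^{3/2}}+\frac{z_{i\alpha}}{2r_i\sqrt{r_{i\alpha}^2+z_{i\alpha}^2}}$$ be the mean curvature of the surface of revolution generated by $\Gamma_i$. For given angles $\beta,\theta_c$, the profile is an (axisymmetric) *steady state* if * $(r_iH_{i\alpha})_\alpha=0$ for $i=1,2$ and $H_3=0$ on $(0,1)$; * $z_1(0)=z_3(0)=0$, $r_2(1)=1$, $(r_1,z_1)(1)=(r_3,z_3)(1)=(r_2,z_2)(0)=:(\bar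 r,\bar z)$, and $r_1(0)<r_3(0)$; * $\theta_1(0)=\theta_c$, $\theta_2(1)=0$, $\theta_3(0)=\pi/2$, $-\theta_1(1)+\theta_3(1)=\beta$, $\theta_2(0)-\theta_3(1)=-\pi+\beta$; * $H_1(1)=H_2(0)$, $H_{1\alpha}(0)=0=H_{2\alpha}(1)$, and $H_{1\alpha}/\sqrt{r_{1\alpha}^2+z_{1\alpha}^2}$ at $\alpha=1$ equals $H_{2\alpha}/\sqrt{r_{2\alpha}^2+z_{2\alpha}^2}$ at $\alpha=0$; * $0<r_1,r_3<1$ on $[0,1]$, $0<r_2<1$ on $[0,1)$, $z_1,z_3>0$ on $(0,1]$, $z_2>0$ on $[0,1]$; * any two of the three curves meet only at $(\bar r,\bar z)$. Its parameters are $(A,\sigma)$, where $A=r_3(0)$ and $\sigma$ is the length of $\Gamma_3$. Put $\Omega_0=\{(A,\sigma): 0<A<1,\ 0<\sigma<\sqrt{1-A^2}\}$ and $\Omega_\varepsilon=\{(A,\sigma)\in\Omega_0: A>1-\varepsilon\}$. Further put $\bar z(A,\sigma)=A\,\mathrm{arcosh}(\sqrt{\sigma^2+A^2}/A)$, $\bar\theta_1=\arcsin(A/\sqrt{\sigma^2+A^2})-\beta$,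 $$\lambda=\frac{A\cos\beta+\sigma\sin\beta}{1-A^2-\sigma^2},\qquad a_\ell=\sqrt{\frac{(2A^2+2\sigma^2-1)A\cos\beta+\sigma\sin\beta}{A\cos\beta+\sigma\sin\beta}},$$ $$Z(A,\sigma,\beta)=\bar z(A,\sigma)-\frac1{2\lambda}\int_{\bar\theta_1}^{\pi}\Bigl(\frac{\sin^2x}{\sqrt{\sin^2x+4\lambda^2a_\ell^2}}-\sin x\Bigr)dx .$$ Call $(A,\sigma,\beta)$ with $(A,\sigma)\in\Omega_0$, $\beta\in(\pi/2,\pi)$ *admissible* if (i) $\tan\beta>\frac A\sigma(1-2A^2-2\sigma^2)$; (ii) $\cos\beta<-\frac{A}{\sqrt{\sigma^2+A^2}}$ implies $\cos\beta<-\frac1{2A}$; (iii) $Z(A,\sigma,\beta)\le0$; (iv) $\tan\beta<\frac{A(1-A^2-2\sigma^2)}{\sigma(1-A^2)}$. **Theorem.** Let $\beta\in(\pi/2,\pi)$ and $\theta_c=\pi$. The parameters of every steady state lie in $\Omega_0$. There are $\varepsilon\in(0,1)$ and a $C^1$ function $\sigma=\sigma(A)$ on $(1-\varepsilon,1)$ such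 that: 1. for every $A\in(1-\varepsilon,1)$, $(A,\sigma(A))\in\Omega_\varepsilon$, the triple $(A,\sigma(A),\beta)$ is admissible, and $Z(A,\sigma(A),\beta)=0$; 2. a point $(A,s)\in\Omega_\varepsilon$ is the pair of parameters of a steady state if and only if $s=\sigma(A)$, and two steady states with the same parameters in $\Omega_\varepsilon$ coincide on $[0,1]$; 3. $\sigma(A)\to0$ as $A\to1^-$, and moreover $$\sigma(A)=\frac{1+\sin\beta}{-\cos\beta}(1-A)+O\bigl((1-A)^2\bigr)\qquad(A\to1^-).$$ In particular there is a continuum of steady states with $\theta_c=\pi$: the set of parameters $(A,\sigma)$ of such steady states has the cardinality of the continuum. -/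

import Mathlib

namespace TwoGrain

noncomputable section

/-- A parametrized curve `α ↦ (r α, z α)`, `α ∈ [0,1]`, in the meridian half plane. Only the values
on `[0,1]` matter. -/
structure MeridianCurve where
  r : ℝ → ℝ
  z : ℝ → ℝ

/-- Derivative with respect to the curve parameter `α ∈ [0,1]` (one-sided at the end points). -/
def dα (f : ℝ → ℝ) : ℝ → ℝ := derivWithin f (Set.Icc 0 1)

namespace MeridianCurve

/-- The point of the curve at parameter `α`. -/
def point (c : MeridianCurve) (α : ℝ) : ℝ × ℝ := (c.r α, c.z α)

/-- The trace of the curve. -/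
def trace (c : MeridianCurve) : Set (ℝ × ℝ) := c.point '' Set.Icc 0 1

/-- `√(r_α² + z_α²)`. -/
def speed (c : MeridianCurve) (α : ℝ) : ℝ := Real.sqrt (dα c.r α ^ 2 + dα c.z α ^ 2)

/-- The length of the curve. -/
def arcLength (c : MeridianCurve) : ℝ := ∫ α in (0 : ℝ)..1, c.speed α

/-- Mean curvature (average of the principal curvatures) of the surface of revolution obtained by
rotating the curve about the `z`-axis. -/
def meanCurv (c : MeridianCurve) (α : ℝ) : ℝ :=
  (dα c.r α * dα (dα c.z) α - dα c.z α * dα (dα c.r) α) / (2 * c.speed α ^ 3)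
    + dα c.z α / (2 * c.r α * c.speed α)

/-- `θ` is the continuous angle, with values in `(-π, π]`, from the positive `r`-axis to the unit
tangent `(r_α, z_α) / √(r_α² + z_α²)`. In particular the speed does not vanish. -/
def IsAngle (c : MeridianCurve) (θ : ℝ → ℝ) : Prop :=
  ContinuousOn θ (Set.Icc 0 1) ∧
    ∀ α ∈ Set.Icc (0 : ℝ) 1, θ α ∈ Set.Ioc (-Real.pi) Real.pi ∧
      Real.cos (θ α) = dα c.r α / c.speed α ∧ Real.sin (θ α) = dα c.z α / c.speed α

/-- The curve is sufficiently smooth up to its end points, is parametrized proportionally to arc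
length (`r_α r_αα + z_α z_αα = 0`), and does not intersect itself. -/
structure IsRegular (c : MeridianCurve) : Prop where
  smooth_r : ContDiffOn ℝ 4 c.r (Set.Icc 0 1)
  smooth_z : ContDiffOn ℝ 4 c.z (Set.Icc 0 1)
  equidistributed : ∀ α ∈ Set.Icc (0 : ℝ) 1,
    dα c.r α * dα (dα c.r) α + dα c.z α * dα (dα c.z) α = 0
  no_self_intersection : Set.InjOn c.point (Set.Icc 0 1)

end MeridianCurve

/-- The profile of a two grain system: `Γ₁`, `Γ₂` generate the exterior surfaces of the inner and of
the outer grain, `Γ₃` generates the grain boundary. -/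
structure Profile where
  Γ₁ : MeridianCurve
  Γ₂ : MeridianCurve
  Γ₃ : MeridianCurve

namespace Profile

/-- The parameters `(A, σ)` of a profile: `A` is the radius at which the grain boundary meets the
substrate, `σ` is the length of `Γ₃`. -/
def params (P : Profile) : ℝ × ℝ := (P.Γ₃.r 0, P.Γ₃.arcLength)

/-- Two profiles are the same if their three curves agree on `[0,1]`. -/
def Same (P Q : Profile) : Prop :=
  Set.EqOn P.Γ₁.point Q.Γ₁.point (Set.Icc 0 1) ∧
  Set.EqOn P.Γ₂.point Q.Γ₂.point (Set.Icc 0 1) ∧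
  Set.EqOn P.Γ₃.point Q.Γ₃.point (Set.Icc 0 1)

/-- Steady states, inside the cylinder of radius `1` above the substrate `z = 0`, of the coupled
motion (surface diffusion of `Γ₁`, `Γ₂`, motion by mean curvature of `Γ₃`). -/
structure IsSteadyState (β θc : ℝ) (P : Profile) : Prop where
  regular₁ : P.Γ₁.IsRegular
  regular₂ : P.Γ₂.IsRegular
  regular₃ : P.Γ₃.IsRegular
  -- zero normal velocity: `(r H_α)_α = 0` (surface diffusion) and `H = 0` (mean curvature motion)
  surface_diffusion₁ : ∀ α ∈ Set.Ioo (0 : ℝ) 1,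
    dα (fun a => P.Γ₁.r a * dα P.Γ₁.meanCurv a) α = 0
  surface_diffusion₂ : ∀ α ∈ Set.Ioo (0 : ℝ) 1,
    dα (fun a => P.Γ₂.r a * dα P.Γ₂.meanCurv a) α = 0
  mean_curvature₃ : ∀ α ∈ Set.Ioo (0 : ℝ) 1, P.Γ₃.meanCurv α = 0
  -- persistence: end points and triple junction
  foot₁ : P.Γ₁.z 0 = 0
  foot₃ : P.Γ₃.z 0 = 0
  wall₂ : P.Γ₂.r 1 = 1
  junction₁₂ : P.Γ₁.point 1 = P.Γ₂.point 0
  junction₃₂ : P.Γ₃.point 1 = P.Γ₂.point 0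
  feet_order : P.Γ₁.r 0 < P.Γ₃.r 0
  -- balance of mechanical forces
  angles : ∃ θ₁ θ₂ θ₃ : ℝ → ℝ,
    P.Γ₁.IsAngle θ₁ ∧ P.Γ₂.IsAngle θ₂ ∧ P.Γ₃.IsAngle θ₃ ∧
    θ₁ 0 = θc ∧ θ₂ 1 = 0 ∧ θ₃ 0 = Real.pi / 2 ∧
    -θ₁ 1 + θ₃ 1 = β ∧ θ₂ 0 - θ₃ 1 = -Real.pi + β
  -- continuity of the chemical potential
  chemical_potential : P.Γ₁.meanCurv 1 = P.Γ₂.meanCurv 0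
  -- balance of mass flux
  flux_foot₁ : dα P.Γ₁.meanCurv 0 = 0
  flux_junction :
    dα P.Γ₁.meanCurv 1 / P.Γ₁.speed 1 = dα P.Γ₂.meanCurv 0 / P.Γ₂.speed 0
  flux_wall₂ : dα P.Γ₂.meanCurv 1 = 0
  -- the hole, the exterior surfaces and the grain boundary persist
  r₁_mem : ∀ α ∈ Set.Icc (0 : ℝ) 1, P.Γ₁.r α ∈ Set.Ioo (0 : ℝ) 1
  r₂_mem : ∀ α ∈ Set.Ico (0 : ℝ) 1, P.Γ₂.r α ∈ Set.Ioo (0 : ℝ) 1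
  r₃_mem : ∀ α ∈ Set.Icc (0 : ℝ) 1, P.Γ₃.r α ∈ Set.Ioo (0 : ℝ) 1
  z₁_pos : ∀ α ∈ Set.Ioc (0 : ℝ) 1, 0 < P.Γ₁.z α
  z₂_pos : ∀ α ∈ Set.Icc (0 : ℝ) 1, 0 < P.Γ₂.z α
  z₃_pos : ∀ α ∈ Set.Ioc (0 : ℝ) 1, 0 < P.Γ₃.z α
  -- the curves meet only at the triple junction
  inter₁₂ : P.Γ₁.trace ∩ P.Γ₂.trace = {P.Γ₂.point 0}
  inter₁₃ : P.Γ₁.trace ∩ P.Γ₃.trace = {P.Γ₂.point 0}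
  inter₂₃ : P.Γ₂.trace ∩ P.Γ₃.trace = {P.Γ₂.point 0}

end Profile

/-- `Ω₀ = {(A, σ) | 0 < A < 1, 0 < σ < √(1 - A²)}`. -/
def Ω₀ : Set (ℝ × ℝ) :=
  {p | 0 < p.1 ∧ p.1 < 1 ∧ 0 < p.2 ∧ p.2 < Real.sqrt (1 - p.1 ^ 2)}

/-- The part of `Ω₀` near `(1, 0)`: `Ω_ε = {(A, σ) ∈ Ω₀ | 1 - ε < A}`. -/
def Ωnear (ε : ℝ) : Set (ℝ × ℝ) := {p | p ∈ Ω₀ ∧ 1 - ε < p.1}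

/-- Height of the triple junction. -/
def zbar (A σ : ℝ) : ℝ := A * Real.arcosh (Real.sqrt (σ ^ 2 + A ^ 2) / A)

/-- Angle of `Γ₁` at the triple junction. -/
def thetabar₁ (A σ β : ℝ) : ℝ := Real.arcsin (A / Real.sqrt (σ ^ 2 + A ^ 2)) - β

/-- Mean curvature of the exterior surfaces. -/
def lam (A σ β : ℝ) : ℝ := (A * Real.cos β + σ * Real.sin β) / (1 - A ^ 2 - σ ^ 2)

/-- The radius at which `Γ₁` has a horizontal tangent. -/
def aell (A σ β : ℝ) : ℝ :=
  Real.sqrt (((2 * A ^ 2 + 2 * σ ^ 2 - 1) * A * Real.cos β + σ * Real.sin β) /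
    (A * Real.cos β + σ * Real.sin β))

/-- Height of the nodary curve carrying `Γ₁` at tangent angle `θ`. -/
def z₁ (A σ β θ : ℝ) : ℝ :=
  -1 / (2 * lam A σ β) *
      (∫ x in (thetabar₁ A σ β)..θ,
        (Real.sin x ^ 2 / Real.sqrt (Real.sin x ^ 2 + 4 * lam A σ β ^ 2 * aell A σ β ^ 2)
          - Real.sin x))
    + zbar A σ

/-- The admissibility constraints on `(A, σ, β)`. -/
structure Admissible (A σ β : ℝ) : Prop where
  mem_Ω₀ : (A, σ) ∈ Ω₀
  beta_mem : β ∈ Set.Ioo (Real.pi / 2) Real.pi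
  tan_gt : A / σ * (1 - 2 * A ^ 2 - 2 * σ ^ 2) < Real.tan β
  cos_lt : Real.cos β < -(A / Real.sqrt (σ ^ 2 + A ^ 2)) → Real.cos β < -(1 / (2 * A))
  z₁_pi_nonpos : z₁ A σ β Real.pi ≤ 0
  tan_lt : Real.tan β < A * (1 - A ^ 2 - 2 * σ ^ 2) / (σ * (1 - A ^ 2))

end

end TwoGrain

namespace TwoGrain

open Set Real

/-! ### Calculus on the unit interval -/

/-! Zero flux at the foot of Γ₁ and at the wall end of Γ₂ turns (r H_α)_α = 0 into constant mean
curvature, and continuity of the chemical potential gives both curves the same constant l. The curve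
Γ₃ has H = 0 and leaves the substrate orthogonally, so it is the catenary fixed by A and σ
(`HasCMCFrame.eq_catenary`).

A curve of constant mean curvature l has the first integral r sin θ − l r². Evaluating it at the
junction and at the far end of Γ₂ gives l = `lam`, and then along Γ₁ it gives the foot radius
`aell`. Near (A, σ) = (1, 0) one has l < 0. Then r sin θ = l (r² − a²) has a single positive root r
for each θ, the tangent angle strictly decreases along the curve, and the curve is a piece of a
nodary parametrized by θ. Its end angles are prescribed, so the parameters determine the whole
profile (`same`). The one remaining condition is that Γ₁ lands on the substrate, z₁(π) = 0.
Conversely, near the corner this condition suffices: the curves built from (A, σ) satisfy all the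
sign, ordering and disjointness requirements (`exists_steadyState`).

At the corner `lam` blows up. Multiplied by −2(A cos β + σ sin β), however, z₁(π) becomes `closing`,
which is C² near (1, 0) (`z₁_pi_mul`, `contDiffAt_closing`). There it vanishes with partial
derivatives 2(1 + sin β) and −2 cos β ≠ 0. The implicit function theorem gives the C² curve σ(A),
its slope, and through a second order Taylor bound the asymptotics; the slope is finite and points
into `Ω₀`, so the curve enters it. The continuum of parameters is the graph of σ over an interval.
-/

theorem uniqueDiffOn_unitInterval : UniqueDiffOn ℝ (Icc (0 : ℝ) 1) :=
  uniqueDiffOn_Icc zero_lt_one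

theorem dα_eq {f : ℝ → ℝ} {f' α : ℝ} (h : HasDerivWithinAt f f' (Icc 0 1) α)
    (hα : α ∈ Icc (0 : ℝ) 1) : dα f α = f' :=
  h.derivWithin (uniqueDiffOn_unitInterval α hα)

theorem dα_congr {f g : ℝ → ℝ} (h : EqOn f g (Icc 0 1)) {α : ℝ} (hα : α ∈ Icc (0 : ℝ) 1) :
    dα f α = dα g α :=
  derivWithin_congr h (h hα)

theorem hasDerivWithinAt_dα {f : ℝ → ℝ} (h : ContDiffOn ℝ 1 f (Icc 0 1)) {α : ℝ}
    (hα : α ∈ Icc (0 : ℝ) 1) : HasDerivWithinAt f (dα f α) (Icc 0 1) α :=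
  (h.differentiableOn one_ne_zero α hα).hasDerivWithinAt

theorem contDiffOn_dα {f : ℝ → ℝ} {m n : WithTop ℕ∞} (h : ContDiffOn ℝ n f (Icc 0 1))
    (hmn : m + 1 ≤ n) : ContDiffOn ℝ m (dα f) (Icc 0 1) :=
  h.derivWithin uniqueDiffOn_unitInterval hmn

/-- A continuous function on `[0,1]` with vanishing derivative in the interior is constant. -/
theorem eq_of_hasDerivWithinAt_zero {f : ℝ → ℝ} (hc : ContinuousOn f (Icc 0 1))
    (h : ∀ α ∈ Ioo (0 : ℝ) 1, HasDerivWithinAt f 0 (Icc 0 1) α) {x y : ℝ}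
    (hx : x ∈ Icc (0 : ℝ) 1) (hy : y ∈ Icc (0 : ℝ) 1) : f x = f y := by
  have hd : ∀ α ∈ interior (Icc (0 : ℝ) 1), HasDerivAt f 0 α := fun α hα => by
    rw [interior_Icc] at hα
    exact (h α hα).hasDerivAt (Icc_mem_nhds hα.1 hα.2)
  have hm : MonotoneOn f (Icc 0 1) :=
    monotoneOn_of_deriv_nonneg (convex_Icc 0 1) hc
      (fun α hα => (hd α hα).differentiableAt.differentiableWithinAt)
      (fun α hα => (hd α hα).deriv.ge)
  have ha : AntitoneOn f (Icc 0 1) :=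
    antitoneOn_of_deriv_nonpos (convex_Icc 0 1) hc
      (fun α hα => (hd α hα).differentiableAt.differentiableWithinAt)
      (fun α hα => (hd α hα).deriv.le)
  rcases le_total x y with hxy | hxy
  · exact le_antisymm (hm hx hy hxy) (ha hx hy hxy)
  · exact le_antisymm (ha hy hx hxy) (hm hy hx hxy)

/-- Functions with the same derivative on `[0,1]` differ by a constant. -/
theorem sub_eq_sub_of_hasDerivWithinAt {f g f' : ℝ → ℝ}
    (hf : ∀ α ∈ Icc (0 : ℝ) 1, HasDerivWithinAt f (f' α) (Icc 0 1) α)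
    (hg : ∀ α ∈ Icc (0 : ℝ) 1, HasDerivWithinAt g (f' α) (Icc 0 1) α) {x y : ℝ}
    (hx : x ∈ Icc (0 : ℝ) 1) (hy : y ∈ Icc (0 : ℝ) 1) : f x - g x = f y - g y := by
  have h : ∀ α ∈ Icc (0 : ℝ) 1, HasDerivWithinAt (fun a => f a - g a) 0 (Icc 0 1) α :=
    fun α hα => by simpa using (hf α hα).fun_sub (hg α hα)
  exact eq_of_hasDerivWithinAt_zero (f := fun a => f a - g a)
    (fun α hα => (h α hα).continuousWithinAt) (fun α hα => h α (Ioo_subset_Icc_self hα)) hx hy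

/-- A continuous angle of a differentiable unit vector field is differentiable. -/
theorem hasDerivWithinAt_angle {θ c s : ℝ → ℝ} {c' s' α : ℝ} {I : Set ℝ}
    (hθ : ContinuousWithinAt θ I α) (hα : α ∈ I) (hcos : ∀ x ∈ I, cos (θ x) = c x)
    (hsin : ∀ x ∈ I, sin (θ x) = s x) (hc : HasDerivWithinAt c c' I α)
    (hs : HasDerivWithinAt s s' I α) :
    HasDerivWithinAt θ (c α * s' - s α * c') I α := by
  have h0 : s α * c α - c α * s α = 0 := by ring
  -- This function is sin(θ x − θ α). By continuity the difference stays in (−π/2, π/2) near α, so θ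
  -- is θ α plus its arcsine, and arcsin has derivative 1 at 0.
  have hu : HasDerivWithinAt (fun x => s x * c α - c x * s α) (s' * c α - c' * s α) I α :=
    (hs.mul_const _).fun_sub (hc.mul_const _)
  have harc : HasDerivAt arcsin 1 (s α * c α - c α * s α) := by
    rw [h0]
    simpa using hasDerivAt_arcsin (x := 0) (by norm_num) (by norm_num)
  have hcomp := (harc.comp_hasDerivWithinAt α hu).const_add (θ α)
  have hnear : ∀ᶠ x in nhdsWithin α I, |θ x - θ α| < π / 2 := by
    have := Metric.tendsto_nhds.1 hθ (π / 2) (by positivity)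
    simpa [Real.dist_eq] using this
  refine (hcomp.congr_of_eventuallyEq ?_ ?_).congr_deriv (by ring)
  · filter_upwards [hnear, self_mem_nhdsWithin] with x hx hxI
    have : s x * c α - c x * s α = sin (θ x - θ α) := by
      rw [sin_sub, hsin x hxI, hcos x hxI, hsin α hα, hcos α hα]
    simp only [Function.comp_apply, this]
    rw [arcsin_sin (by linarith [(abs_lt.1 hx).1]) (by linarith [(abs_lt.1 hx).2])]
    ring
  · simp [h0]

/-- Angles in `(-π, π]` are determined by their cosine and sine. -/
theorem angle_unique {x y : ℝ} (hx : x ∈ Ioc (-π) π) (hy : y ∈ Ioc (-π) π)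
    (hc : cos x = cos y) (hs : sin x = sin y) : x = y := by
  have h : cos (x - y) = 1 := by
    rw [cos_sub, hc, hs, ← sq, ← sq, cos_sq_add_sin_sq]
  have := (cos_eq_one_iff_of_lt_of_lt (by linarith [hx.1, hy.2]) (by linarith [hx.2, hy.1])).1 h
  linarith

namespace MeridianCurve

/-! ### Curves with a moving frame -/

/-- The curve has constant speed `L` and tangent angle `θ`, with `θ_α = κ`. -/
structure HasFrame (c : MeridianCurve) (L : ℝ) (θ κ : ℝ → ℝ) : Prop where
  pos : 0 < L
  deriv_r : ∀ α ∈ Icc (0 : ℝ) 1, HasDerivWithinAt c.r (L * cos (θ α)) (Icc 0 1) α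
  deriv_z : ∀ α ∈ Icc (0 : ℝ) 1, HasDerivWithinAt c.z (L * sin (θ α)) (Icc 0 1) α
  deriv_angle : ∀ α ∈ Icc (0 : ℝ) 1, HasDerivWithinAt θ (κ α) (Icc 0 1) α

namespace HasFrame

variable {c : MeridianCurve} {L : ℝ} {θ κ : ℝ → ℝ} {α : ℝ}

theorem dα_r (h : c.HasFrame L θ κ) (hα : α ∈ Icc (0 : ℝ) 1) : dα c.r α = L * cos (θ α) :=
  dα_eq (h.deriv_r α hα) hα

theorem dα_z (h : c.HasFrame L θ κ) (hα : α ∈ Icc (0 : ℝ) 1) : dα c.z α = L * sin (θ α) :=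
  dα_eq (h.deriv_z α hα) hα

theorem dα_dα_r (h : c.HasFrame L θ κ) (hα : α ∈ Icc (0 : ℝ) 1) :
    dα (dα c.r) α = -(L * sin (θ α) * κ α) := by
  rw [dα_congr (g := fun a => L * cos (θ a)) (fun a ha => h.dα_r ha) hα,
    dα_eq ((h.deriv_angle α hα).cos.const_mul L) hα]
  ring

theorem dα_dα_z (h : c.HasFrame L θ κ) (hα : α ∈ Icc (0 : ℝ) 1) :
    dα (dα c.z) α = L * cos (θ α) * κ α := by
  rw [dα_congr (g := fun a => L * sin (θ a)) (fun a ha => h.dα_z ha) hα,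
    dα_eq ((h.deriv_angle α hα).sin.const_mul L) hα]
  ring

theorem speed_eq (h : c.HasFrame L θ κ) (hα : α ∈ Icc (0 : ℝ) 1) : c.speed α = L := by
  rw [speed, h.dα_r hα, h.dα_z hα]
  have : (L * cos (θ α)) ^ 2 + (L * sin (θ α)) ^ 2 = L ^ 2 := by
    linear_combination L ^ 2 * cos_sq_add_sin_sq (θ α)
  rw [this, sqrt_sq h.pos.le]

theorem arcLength_eq (h : c.HasFrame L θ κ) : c.arcLength = L := by
  rw [arcLength, intervalIntegral.integral_congr (g := fun _ => L)]
  · simp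
  · intro α hα
    rw [uIcc_of_le zero_le_one] at hα
    exact h.speed_eq hα

theorem meanCurv_eq (h : c.HasFrame L θ κ) (hα : α ∈ Icc (0 : ℝ) 1) :
    c.meanCurv α = κ α / (2 * L) + sin (θ α) / (2 * c.r α) := by
  have hL := h.pos.ne'
  rw [meanCurv, h.dα_r hα, h.dα_z hα, h.dα_dα_r hα, h.dα_dα_z hα, h.speed_eq hα]
  congr 1
  · rw [div_eq_div_iff (by positivity) (by positivity)]
    linear_combination 2 * L ^ 3 * κ α * cos_sq_add_sin_sq (θ α)
  · rw [show 2 * c.r α * L = L * (2 * c.r α) by ring, mul_div_mul_left _ _ hL]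

theorem equidistributed (h : c.HasFrame L θ κ) (hα : α ∈ Icc (0 : ℝ) 1) :
    dα c.r α * dα (dα c.r) α + dα c.z α * dα (dα c.z) α = 0 := by
  rw [h.dα_r hα, h.dα_z hα, h.dα_dα_r hα, h.dα_dα_z hα]
  ring

theorem isAngle (h : c.HasFrame L θ κ) (hθ : ∀ α ∈ Icc (0 : ℝ) 1, θ α ∈ Ioc (-π) π) :
    c.IsAngle θ := by
  refine ⟨fun α hα => (h.deriv_angle α hα).continuousWithinAt, fun α hα => ⟨hθ α hα, ?_, ?_⟩⟩
  · rw [h.dα_r hα, h.speed_eq hα, mul_div_cancel_left₀ _ h.pos.ne']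
  · rw [h.dα_z hα, h.speed_eq hα, mul_div_cancel_left₀ _ h.pos.ne']

end HasFrame

/-! ### Regular curves -/

/-- Equidistribution says that r_α² + z_α² has zero derivative, so the speed is a constant L. The
turning rate is the definition of H solved for θ_α. -/
theorem IsRegular.exists_hasFrame {c : MeridianCurve} (hc : c.IsRegular) {θ : ℝ → ℝ}
    (hθ : c.IsAngle θ) (hr : ∀ α ∈ Icc (0 : ℝ) 1, 0 < c.r α) :
    ∃ L, c.HasFrame L θ fun α => L * (2 * c.meanCurv α - sin (θ α) / c.r α) := by
  have h1r : ContDiffOn ℝ 3 (dα c.r) (Icc 0 1) := contDiffOn_dα hc.smooth_r (by norm_num)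
  have h1z : ContDiffOn ℝ 3 (dα c.z) (Icc 0 1) := contDiffOn_dα hc.smooth_z (by norm_num)
  have hq : ∀ α ∈ Icc (0 : ℝ) 1,
      HasDerivWithinAt (fun a => dα c.r a ^ 2 + dα c.z a ^ 2) 0 (Icc 0 1) α := fun α hα => by
    have := ((hasDerivWithinAt_dα (h1r.of_le (by norm_num)) hα).fun_pow 2).fun_add
      ((hasDerivWithinAt_dα (h1z.of_le (by norm_num)) hα).fun_pow 2)
    refine this.congr_deriv ?_
    have := hc.equidistributed α hα
    norm_num
    linear_combination 2 * this
  have h0 : (0 : ℝ) ∈ Icc (0 : ℝ) 1 := by norm_num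
  have hspeed : ∀ α ∈ Icc (0 : ℝ) 1, c.speed α = c.speed 0 := fun α hα => by
    have := eq_of_hasDerivWithinAt_zero (f := fun a => dα c.r a ^ 2 + dα c.z a ^ 2)
      (fun α hα => (hq α hα).continuousWithinAt)
      (fun α hα => hq α (Ioo_subset_Icc_self hα)) hα h0
    simp only [speed]
    exact congrArg sqrt this
  set L := c.speed 0 with hL
  have hpos : 0 < L := by
    have hnn : 0 ≤ c.speed 0 := sqrt_nonneg _
    rcases hnn.lt_or_eq with h | h
    · exact h
    · exfalso
      -- Since `x / 0 = 0`, zero speed would make the cosine and the sine of the angle vanish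
      -- together.
      have h2 := (hθ.2 0 h0).2
      rw [← h, div_zero, div_zero] at h2
      have := cos_sq_add_sin_sq (θ 0)
      rw [h2.1, h2.2] at this
      norm_num at this
  have hcos : ∀ α ∈ Icc (0 : ℝ) 1, cos (θ α) = dα c.r α / L := fun α hα => by
    rw [(hθ.2 α hα).2.1, hspeed α hα]
  have hsin : ∀ α ∈ Icc (0 : ℝ) 1, sin (θ α) = dα c.z α / L := fun α hα => by
    rw [(hθ.2 α hα).2.2, hspeed α hα]
  refine ⟨L, hpos, fun α hα => ?_, fun α hα => ?_, fun α hα => ?_⟩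
  · rw [hcos α hα, mul_div_cancel₀ _ hpos.ne']
    exact hasDerivWithinAt_dα (hc.smooth_r.of_le (by norm_num)) hα
  · rw [hsin α hα, mul_div_cancel₀ _ hpos.ne']
    exact hasDerivWithinAt_dα (hc.smooth_z.of_le (by norm_num)) hα
  · refine (hasDerivWithinAt_angle (hθ.1 α hα) hα hcos hsin
      ((hasDerivWithinAt_dα (h1r.of_le (by norm_num)) hα).div_const L)
      ((hasDerivWithinAt_dα (h1z.of_le (by norm_num)) hα).div_const L)).congr_deriv ?_
    have hr' : c.r α ≠ 0 := (hr α hα).ne'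
    rw [meanCurv, hspeed α hα, hsin α hα]
    have hL' := hpos.ne'
    field_simp
    ring

/-- Four derivatives of the curve leave two for H, so that r H_α is C¹ and the diffusion equation is
a statement about a genuine derivative. -/
theorem IsRegular.contDiffOn_meanCurv {c : MeridianCurve} (hc : c.IsRegular) {θ : ℝ → ℝ}
    (hθ : c.IsAngle θ) (hr : ∀ α ∈ Icc (0 : ℝ) 1, 0 < c.r α) :
    ContDiffOn ℝ 2 c.meanCurv (Icc 0 1) := by
  obtain ⟨L, hL⟩ := hc.exists_hasFrame hθ hr
  have h1r : ContDiffOn ℝ 3 (dα c.r) (Icc 0 1) := contDiffOn_dα hc.smooth_r (by norm_num)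
  have h1z : ContDiffOn ℝ 3 (dα c.z) (Icc 0 1) := contDiffOn_dα hc.smooth_z (by norm_num)
  have h2r : ContDiffOn ℝ 2 (dα (dα c.r)) (Icc 0 1) := contDiffOn_dα h1r (by norm_num)
  have h2z : ContDiffOn ℝ 2 (dα (dα c.z)) (Icc 0 1) := contDiffOn_dα h1z (by norm_num)
  have h1r' := h1r.of_le (show (2 : WithTop ℕ∞) ≤ 3 by norm_num)
  have h1z' := h1z.of_le (show (2 : WithTop ℕ∞) ≤ 3 by norm_num)
  have hr' := hc.smooth_r.of_le (show (2 : WithTop ℕ∞) ≤ 4 by norm_num)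
  have key : ContDiffOn ℝ 2 (fun α =>
      (dα c.r α * dα (dα c.z) α - dα c.z α * dα (dα c.r) α) / (2 * L ^ 3)
        + dα c.z α / (2 * c.r α * L)) (Icc 0 1) := by
    refine (((h1r'.mul h2z).sub (h1z'.mul h2r)).div_const _).add
      (h1z'.div ((contDiffOn_const.mul hr').mul contDiffOn_const) fun α hα => ?_)
    have := hr α hα
    have := hL.pos
    positivity
  exact key.congr fun α hα => by rw [meanCurv, hL.speed_eq hα]

/-- Surface diffusion without flux at one of the end points: the mean curvature is constant. -/
theorem IsRegular.meanCurv_const {c : MeridianCurve} (hc : c.IsRegular) {θ : ℝ → ℝ}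
    (hθ : c.IsAngle θ) (hr : ∀ α ∈ Icc (0 : ℝ) 1, 0 < c.r α)
    (hd : ∀ α ∈ Ioo (0 : ℝ) 1, dα (fun a => c.r a * dα c.meanCurv a) α = 0)
    {e : ℝ} (he : e ∈ Icc (0 : ℝ) 1) (hflux : dα c.meanCurv e = 0) {x y : ℝ}
    (hx : x ∈ Icc (0 : ℝ) 1) (hy : y ∈ Icc (0 : ℝ) 1) : c.meanCurv x = c.meanCurv y := by
  have hH := hc.contDiffOn_meanCurv hθ hr
  have h1 : ContDiffOn ℝ 1 (dα c.meanCurv) (Icc 0 1) := contDiffOn_dα hH (by norm_num)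
  have hp : ContDiffOn ℝ 1 (fun a => c.r a * dα c.meanCurv a) (Icc 0 1) :=
    (hc.smooth_r.of_le (by norm_num)).mul h1
  have hz : ∀ α ∈ Icc (0 : ℝ) 1, dα c.meanCurv α = 0 := fun α hα => by
    have := eq_of_hasDerivWithinAt_zero hp.continuousOn
      (fun a ha => hd a ha ▸ hasDerivWithinAt_dα hp (Ioo_subset_Icc_self ha)) hα he
    rw [hflux, mul_zero] at this
    exact (mul_eq_zero.1 this).resolve_left (hr α hα).ne'
  exact eq_of_hasDerivWithinAt_zero hH.continuousOn (fun a ha =>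
    hz a (Ioo_subset_Icc_self ha) ▸ hasDerivWithinAt_dα (hH.of_le (by norm_num))
      (Ioo_subset_Icc_self ha)) hx hy

end MeridianCurve

end TwoGrain

namespace TwoGrain

open Set Real

open scoped ContDiff

/-! ### Nodary curves

A curve generating a surface of constant mean curvature `l < 0` which passes the radius `a > 0` with
a horizontal tangent satisfies `r sin θ = l (r² - a²)`; it is parametrized by its tangent angle. -/

noncomputable section

/-- The root of the discriminant of `l r² - r sin x - l a² = 0`. -/
def nodS (l a x : ℝ) : ℝ := √(sin x ^ 2 + 4 * l ^ 2 * a ^ 2)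

/-- The radius of the nodary at tangent angle `x`. -/
def nodR (l a x : ℝ) : ℝ := (sin x - nodS l a x) / (2 * l)

/-- The negative of the arc length of the nodary as a function of the tangent angle. -/
def nodT (l a x : ℝ) : ℝ := ∫ t in (0 : ℝ)..x, nodR l a t / nodS l a t

/-- The height of the nodary as a function of the tangent angle, up to a constant. -/
def nodZ (l a x : ℝ) : ℝ :=
  -1 / (2 * l) * ∫ t in (0 : ℝ)..x, (sin t ^ 2 / nodS l a t - sin t)

end

section Nodary

variable {l a : ℝ}

theorem nodS_sq (l a x : ℝ) : nodS l a x ^ 2 = sin x ^ 2 + 4 * l ^ 2 * a ^ 2 :=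
  sq_sqrt (by positivity)

theorem nodS_arg_pos (hl : l < 0) (ha : 0 < a) (x : ℝ) : 0 < sin x ^ 2 + 4 * l ^ 2 * a ^ 2 := by
  have : 0 < l ^ 2 := by nlinarith
  positivity

theorem nodS_pos (hl : l < 0) (ha : 0 < a) (x : ℝ) : 0 < nodS l a x :=
  sqrt_pos.2 (nodS_arg_pos hl ha x)

theorem abs_sin_lt_nodS (hl : l < 0) (ha : 0 < a) (x : ℝ) : |sin x| < nodS l a x := by
  refine abs_lt_of_sq_lt_sq ?_ (nodS_pos hl ha x).le
  rw [nodS_sq]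
  have : 0 < l ^ 2 := by nlinarith
  have : 0 < 4 * l ^ 2 * a ^ 2 := by positivity
  linarith

theorem two_mul_nodR (hl : l < 0) (a x : ℝ) : 2 * l * nodR l a x = sin x - nodS l a x := by
  rw [nodR, mul_div_cancel₀ _ (by linarith)]

theorem nodR_pos (hl : l < 0) (ha : 0 < a) (x : ℝ) : 0 < nodR l a x :=
  div_pos_of_neg_of_neg
    (by linarith [(abs_lt.1 (abs_sin_lt_nodS hl ha x)).2]) (by linarith)

theorem nodR_mul_sin (hl : l < 0) (a x : ℝ) :
    nodR l a x * sin x = l * (nodR l a x ^ 2 - a ^ 2) := by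
  have h1 := two_mul_nodR hl a x
  have h2 := nodS_sq l a x
  have h3 : l ≠ 0 := hl.ne
  have h4 : l * (nodR l a x * sin x - l * (nodR l a x ^ 2 - a ^ 2)) = 0 := by
    have : nodS l a x = sin x - 2 * l * nodR l a x := by linarith
    rw [this] at h2
    linear_combination (-1 / 4) * h2
  linarith [(mul_eq_zero.1 h4).resolve_left h3]

/-- The two roots of l r² − r sin x − l a² = 0 have product −a² < 0, so only one is positive. In the
proof, the difference of the two equations factors as l (r − R)(r R + a²). -/
theorem eq_nodR (hl : l < 0) (ha : 0 < a) {r x : ℝ} (hr : 0 < r)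
    (h : r * sin x = l * (r ^ 2 - a ^ 2)) : r = nodR l a x := by
  have hR := nodR_pos hl ha x
  have h1 := nodR_mul_sin hl a x
  have h2 : l * (r - nodR l a x) * (r * nodR l a x + a ^ 2) = 0 := by
    linear_combination (-nodR l a x) * h + r * h1
  have h3 : r * nodR l a x + a ^ 2 ≠ 0 := by positivity
  have h4 := (mul_eq_zero.1 ((mul_eq_zero.1 h2).resolve_right h3)).resolve_left hl.ne
  linarith

/-- The left side is the turning rate of the tangent angle per unit length. Its negative sign is
what allows the angle to serve as a parameter. -/
theorem two_mul_sub_sin_div_nodR (hl : l < 0) (ha : 0 < a) (x : ℝ) :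
    2 * l - sin x / nodR l a x = -(nodS l a x / nodR l a x) := by
  have hR := (nodR_pos hl ha x).ne'
  have := two_mul_nodR hl a x
  field_simp
  linarith

theorem contDiff_nodS (hl : l < 0) (ha : 0 < a) : ContDiff ℝ ∞ (nodS l a) :=
  ContDiff.sqrt (by fun_prop) fun x => (nodS_arg_pos hl ha x).ne'

theorem contDiff_nodR (hl : l < 0) (ha : 0 < a) : ContDiff ℝ ∞ (nodR l a) :=
  (contDiff_sin.sub (contDiff_nodS hl ha)).div_const _

theorem contDiff_integral {f : ℝ → ℝ} (hf : ContDiff ℝ ∞ f) :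
    ContDiff ℝ ∞ fun x => ∫ t in (0 : ℝ)..x, f t := by
  have hd : ∀ x, HasDerivAt (fun x => ∫ t in (0 : ℝ)..x, f t) (f x) x := fun x =>
    intervalIntegral.integral_hasDerivAt_right (hf.continuous.intervalIntegrable _ _)
      (hf.continuous.stronglyMeasurableAtFilter _ _) hf.continuous.continuousAt
  rw [contDiff_infty_iff_deriv]
  refine ⟨fun x => (hd x).differentiableAt, ?_⟩
  rwa [funext fun x => (hd x).deriv]

theorem hasDerivAt_nodT (hl : l < 0) (ha : 0 < a) (x : ℝ) :
    HasDerivAt (nodT l a) (nodR l a x / nodS l a x) x := by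
  have hc : Continuous fun x => nodR l a x / nodS l a x :=
    (contDiff_nodR hl ha).continuous.div₀ (contDiff_nodS hl ha).continuous
      fun x => (nodS_pos hl ha x).ne'
  exact intervalIntegral.integral_hasDerivAt_right (hc.intervalIntegrable _ _)
    (hc.stronglyMeasurableAtFilter _ _) hc.continuousAt

theorem contDiff_nodZ_integrand (hl : l < 0) (ha : 0 < a) :
    ContDiff ℝ ∞ fun t => sin t ^ 2 / nodS l a t - sin t :=
  ((contDiff_sin.pow 2).div (contDiff_nodS hl ha) fun x => (nodS_pos hl ha x).ne').sub contDiff_sin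

theorem contDiff_nodZ (hl : l < 0) (ha : 0 < a) : ContDiff ℝ ∞ (nodZ l a) :=
  contDiff_const.mul (contDiff_integral (contDiff_nodZ_integrand hl ha))

theorem hasDerivAt_nodZ (hl : l < 0) (ha : 0 < a) (x : ℝ) :
    HasDerivAt (nodZ l a) (-(sin x * nodR l a x / nodS l a x)) x := by
  have hc := (contDiff_nodZ_integrand hl ha).continuous
  have := (intervalIntegral.integral_hasDerivAt_right (hc.intervalIntegrable 0 x)
    (hc.stronglyMeasurableAtFilter _ _) hc.continuousAt).const_mul (-1 / (2 * l))
  refine this.congr_deriv ?_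
  have hS := (nodS_pos hl ha x).ne'
  have hl' := hl.ne
  rw [nodR]
  field_simp

theorem nodT_strictMono (hl : l < 0) (ha : 0 < a) : StrictMono (nodT l a) :=
  strictMono_of_deriv_pos fun x => by
    rw [(hasDerivAt_nodT hl ha x).deriv]
    exact div_pos (nodR_pos hl ha x) (nodS_pos hl ha x)

theorem nodT_zero (l a : ℝ) : nodT l a 0 = 0 := by simp [nodT]

/-- The quotient is continuous, positive and 2π-periodic, so it attains a positive minimum over one
period. This makes `nodT` grow at least linearly and hence be onto. -/
theorem exists_nodT_deriv_ge (hl : l < 0) (ha : 0 < a) :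
    ∃ m > 0, ∀ x, m ≤ nodR l a x / nodS l a x := by
  have hper : Function.Periodic (fun x => nodR l a x / nodS l a x) (2 * π) := fun x => by
    simp [nodR, nodS]
  have hc : Continuous fun x => nodR l a x / nodS l a x :=
    (contDiff_nodR hl ha).continuous.div₀ (contDiff_nodS hl ha).continuous
      fun x => (nodS_pos hl ha x).ne'
  obtain ⟨x₀, -, hx₀⟩ := isCompact_Icc.exists_isMinOn (nonempty_Icc.2 two_pi_pos.le)
    (hc.continuousOn (s := Icc 0 (2 * π)))
  refine ⟨_, div_pos (nodR_pos hl ha x₀) (nodS_pos hl ha x₀), fun x => ?_⟩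
  obtain ⟨y, hy, hxy⟩ := hper.exists_mem_Ico₀ two_pi_pos x
  rw [hxy]
  exact hx₀ (Ico_subset_Icc_self hy)

theorem nodT_surjective (hl : l < 0) (ha : 0 < a) : Function.Surjective (nodT l a) := by
  obtain ⟨m, hm, hle⟩ := exists_nodT_deriv_ge hl ha
  have hcont : Continuous (nodT l a) :=
    continuous_iff_continuousAt.2 fun x => (hasDerivAt_nodT hl ha x).continuousAt
  have hmono : Monotone fun x => nodT l a x - m * x := by
    have hd : ∀ x, HasDerivAt (fun x => nodT l a x - m * x)
        (nodR l a x / nodS l a x - m) x := fun x => by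
      simpa using (hasDerivAt_nodT hl ha x).fun_sub ((hasDerivAt_id x).const_mul m)
    refine monotone_of_deriv_nonneg (fun x => (hd x).differentiableAt) fun x => ?_
    rw [(hd x).deriv]
    linarith [hle x]
  have h0 : nodT l a 0 - m * 0 = 0 := by rw [nodT_zero]; ring
  refine hcont.surjective ?_ ?_
  · refine Filter.tendsto_atTop_mono' _ ?_ (Filter.tendsto_id.const_mul_atTop hm)
    filter_upwards [Filter.eventually_ge_atTop 0] with x hx
    have := hmono hx
    simp only [h0] at this
    simpa using this
  · refine Filter.tendsto_atBot_mono' _ ?_ (Filter.tendsto_id.const_mul_atBot hm)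
    filter_upwards [Filter.eventually_le_atBot 0] with x hx
    have := hmono hx
    simp only [h0] at this
    simpa using this

/-- Solutions of an autonomous equation with smooth right hand side are smooth. -/
theorem contDiff_of_autonomous {g G : ℝ → ℝ} (hg : ContDiff ℝ ∞ g)
    (hG : ∀ y, HasDerivAt G (g (G y)) y) : ContDiff ℝ ∞ G := by
  rw [contDiff_infty]
  intro n
  induction n with
  | zero =>
    exact contDiff_zero.2 (continuous_iff_continuousAt.2 fun y => (hG y).continuousAt)
  | succ n ih =>
    rw [Nat.cast_succ, contDiff_succ_iff_deriv]
    refine ⟨fun y => (hG y).differentiableAt, by simp, ?_⟩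
    rw [funext fun y => (hG y).deriv]
    exact (contDiff_infty.1 hg n).comp ih

/-- The tangent angle of a nodary as a function of arc length. -/
theorem exists_nodary_angle (hl : l < 0) (ha : 0 < a) {x₀ x₁ : ℝ} (hx : x₁ < x₀) :
    ∃ L > 0, ∃ θ : ℝ → ℝ, ContDiff ℝ ∞ θ ∧ StrictAnti θ ∧ θ 0 = x₀ ∧ θ 1 = x₁ ∧
      ∀ α, HasDerivAt θ (-(L * (nodS l a (θ α) / nodR l a (θ α)))) α := by
  -- Arc length from the angle x₀ is nodT x₀ − nodT θ, so the angle is a global inverse of `nodT` at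
  -- nodT x₀ − L α, with L the total length of the piece.
  let e : ℝ ≃o ℝ := StrictMono.orderIsoOfSurjective _ (nodT_strictMono hl ha)
    (nodT_surjective hl ha)
  have he : ∀ x, e x = nodT l a x := fun x => rfl
  have hd : ∀ y, HasDerivAt e.symm (nodS l a (e.symm y) / nodR l a (e.symm y)) y := fun y => by
    have := HasDerivAt.of_local_left_inverse (f := nodT l a) (g := e.symm) (a := y)
      e.symm.continuous.continuousAt (hasDerivAt_nodT hl ha (e.symm y))
      (div_pos (nodR_pos hl ha _) (nodS_pos hl ha _)).ne'
      (Filter.Eventually.of_forall fun y => by rw [← he, e.apply_symm_apply])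
    rwa [inv_div] at this
  have hsm : ContDiff ℝ ∞ e.symm :=
    contDiff_of_autonomous (g := fun x => nodS l a x / nodR l a x)
      ((contDiff_nodS hl ha).div (contDiff_nodR hl ha) fun x => (nodR_pos hl ha x).ne') hd
  have hL : 0 < nodT l a x₀ - nodT l a x₁ := sub_pos.2 (nodT_strictMono hl ha hx)
  set L := nodT l a x₀ - nodT l a x₁ with hLdef
  refine ⟨L, hL, fun α => e.symm (nodT l a x₀ - L * α), ?_, ?_, ?_, ?_, fun α => ?_⟩
  · exact hsm.comp (by fun_prop)
  · intro α α' h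
    refine e.symm.strictMono ?_
    nlinarith
  · simp only [mul_zero, sub_zero]
    rw [← he, e.symm_apply_apply]
  · simp only [mul_one, hLdef, sub_sub_cancel]
    rw [← he, e.symm_apply_apply]
  · have h1 : HasDerivAt (fun α => nodT l a x₀ - L * α) (-L) α := by
      simpa using ((hasDerivAt_id α).const_mul L).const_sub (nodT l a x₀)
    refine ((hd _).comp α h1).congr_deriv ?_
    ring

end Nodary

/-! ### Curves of constant mean curvature -/

namespace MeridianCurve

theorem HasFrame.congr {c : MeridianCurve} {L : ℝ} {θ κ κ' : ℝ → ℝ} (h : c.HasFrame L θ κ)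
    (hκ : EqOn κ κ' (Icc 0 1)) : c.HasFrame L θ κ' :=
  ⟨h.pos, h.deriv_r, h.deriv_z, fun α hα => hκ hα ▸ h.deriv_angle α hα⟩

/-- The frame equations of a curve of constant mean curvature `l`. -/
def HasCMCFrame (c : MeridianCurve) (l L : ℝ) (θ : ℝ → ℝ) : Prop :=
  c.HasFrame L θ fun α => L * (2 * l - sin (θ α) / c.r α)

namespace HasCMCFrame

variable {c c' : MeridianCurve} {l a L L' : ℝ} {θ θ' : ℝ → ℝ}

theorem meanCurv_eq (h : c.HasCMCFrame l L θ) {α : ℝ} (hα : α ∈ Icc (0 : ℝ) 1) :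
    c.meanCurv α = l := by
  rw [HasFrame.meanCurv_eq h hα]
  have hL := h.pos.ne'
  -- At r = 0 both terms divided by r are 0 by convention, so no positivity of r is needed.
  rcases eq_or_ne (c.r α) 0 with h0 | h0
  · rw [h0]
    field_simp
    ring
  · field_simp
    ring

/-- The first integral of the frame equations. -/
theorem first_integral (h : c.HasCMCFrame l L θ) (hr : ∀ α ∈ Icc (0 : ℝ) 1, 0 < c.r α) {x y : ℝ}
    (hx : x ∈ Icc (0 : ℝ) 1) (hy : y ∈ Icc (0 : ℝ) 1) :
    c.r x * sin (θ x) - l * c.r x ^ 2 = c.r y * sin (θ y) - l * c.r y ^ 2 := by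
  have hd : ∀ α ∈ Icc (0 : ℝ) 1,
      HasDerivWithinAt (fun α => c.r α * sin (θ α) - l * c.r α ^ 2) 0 (Icc 0 1) α := fun α hα => by
    refine (((h.deriv_r α hα).fun_mul (h.deriv_angle α hα).sin).fun_sub
      (((h.deriv_r α hα).fun_pow 2).const_mul l)).congr_deriv ?_
    have := (hr α hα).ne'
    push_cast
    field_simp
    ring
  exact eq_of_hasDerivWithinAt_zero (f := fun α => c.r α * sin (θ α) - l * c.r α ^ 2)
    (fun α hα => (hd α hα).continuousWithinAt) (fun α hα => hd α (Ioo_subset_Icc_self hα)) hx hy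

theorem r_eq_nodR (h : c.HasCMCFrame l L θ) (hr : ∀ α ∈ Icc (0 : ℝ) 1, 0 < c.r α) (hl : l < 0)
    (ha : 0 < a) {e : ℝ} (he : e ∈ Icc (0 : ℝ) 1)
    (hra : c.r e * sin (θ e) = l * (c.r e ^ 2 - a ^ 2)) {α : ℝ} (hα : α ∈ Icc (0 : ℝ) 1) :
    c.r α = nodR l a (θ α) :=
  eq_nodR hl ha (hr α hα) (by linarith [h.first_integral hr hα he])

theorem deriv_angle_eq (h : c.HasCMCFrame l L θ) (hl : l < 0) (ha : 0 < a)
    (hR : ∀ α ∈ Icc (0 : ℝ) 1, c.r α = nodR l a (θ α)) {α : ℝ} (hα : α ∈ Icc (0 : ℝ) 1) :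
    HasDerivWithinAt θ (-(L * (nodS l a (θ α) / nodR l a (θ α)))) (Icc 0 1) α := by
  refine (h.deriv_angle α hα).congr_deriv ?_
  rw [hR α hα, two_mul_sub_sin_div_nodR hl ha, mul_neg]

/-- θ_α = −L S/R cancels against the derivative R/S of `nodT`, so `nodT` is a clock running linearly
along the curve. The end angles therefore fix both the length and the whole angle function. -/
theorem nodT_angle (h : c.HasCMCFrame l L θ) (hl : l < 0) (ha : 0 < a)
    (hR : ∀ α ∈ Icc (0 : ℝ) 1, c.r α = nodR l a (θ α)) {α : ℝ} (hα : α ∈ Icc (0 : ℝ) 1) :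
    nodT l a (θ α) = nodT l a (θ 0) - L * α := by
  have h1 : ∀ α ∈ Icc (0 : ℝ) 1,
      HasDerivWithinAt (fun α => nodT l a (θ α)) (-L) (Icc 0 1) α := fun α hα => by
    refine ((hasDerivAt_nodT hl ha (θ α)).comp_hasDerivWithinAt α
      (h.deriv_angle_eq hl ha hR hα)).congr_deriv ?_
    have h1 := (nodR_pos hl ha (θ α)).ne'
    have h2 := (nodS_pos hl ha (θ α)).ne'
    field_simp
  have h2 : ∀ α ∈ Icc (0 : ℝ) 1, HasDerivWithinAt (fun α => -L * α) (-L) (Icc 0 1) α :=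
    fun α _ => by simpa using ((hasDerivAt_id α).const_mul (-L)).hasDerivWithinAt
  have := sub_eq_sub_of_hasDerivWithinAt (f' := fun _ => -L) h1 h2 hα
    (left_mem_Icc.2 zero_le_one)
  linarith

/-- Along the curve both heights have derivative L sin θ, so a height difference depends only on the
tangent angles. -/
theorem z_sub_nodZ (h : c.HasCMCFrame l L θ) (hl : l < 0) (ha : 0 < a)
    (hR : ∀ α ∈ Icc (0 : ℝ) 1, c.r α = nodR l a (θ α)) {x y : ℝ} (hx : x ∈ Icc (0 : ℝ) 1)
    (hy : y ∈ Icc (0 : ℝ) 1) : c.z x - nodZ l a (θ x) = c.z y - nodZ l a (θ y) := by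
  refine sub_eq_sub_of_hasDerivWithinAt (g := fun α => nodZ l a (θ α)) h.deriv_z
    (fun α hα => ?_) hx hy
  refine ((hasDerivAt_nodZ hl ha (θ α)).comp_hasDerivWithinAt α
      (h.deriv_angle_eq hl ha hR hα)).congr_deriv ?_
  have h1 := (nodR_pos hl ha (θ α)).ne'
  have h2 := (nodS_pos hl ha (θ α)).ne'
  field_simp

/-- A piece of a nodary is determined by the tangent angles and the height at its end points. -/
theorem eqOn_point (h : c.HasCMCFrame l L θ) (h' : c'.HasCMCFrame l L' θ') (hl : l < 0)
    (ha : 0 < a) (hR : ∀ α ∈ Icc (0 : ℝ) 1, c.r α = nodR l a (θ α))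
    (hR' : ∀ α ∈ Icc (0 : ℝ) 1, c'.r α = nodR l a (θ' α)) (h0 : θ 0 = θ' 0) (h1 : θ 1 = θ' 1)
    {e : ℝ} (he : e ∈ Icc (0 : ℝ) 1) (hz : c.z e = c'.z e) :
    EqOn c.point c'.point (Icc 0 1) := by
  have hLL : L = L' := by
    have e1 := h.nodT_angle hl ha hR (right_mem_Icc.2 zero_le_one)
    have e2 := h'.nodT_angle hl ha hR' (right_mem_Icc.2 zero_le_one)
    rw [← h0, ← h1] at e2
    linarith
  have hθ : ∀ α ∈ Icc (0 : ℝ) 1, θ α = θ' α := fun α hα => by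
    refine (nodT_strictMono hl ha).injective ?_
    rw [h.nodT_angle hl ha hR hα, h'.nodT_angle hl ha hR' hα, h0, hLL]
  intro α hα
  have e1 := h.z_sub_nodZ hl ha hR hα he
  have e2 := h'.z_sub_nodZ hl ha hR' hα he
  rw [← hθ α hα, ← hθ e he] at e2
  simp only [point, Prod.mk.injEq]
  exact ⟨by rw [hR α hα, hR' α hα, hθ α hα], by linarith⟩

end HasCMCFrame

/-- Existence of a piece of a nodary with prescribed tangent angles at its end points. -/
theorem exists_nodary {l a : ℝ} (hl : l < 0) (ha : 0 < a) {x₀ x₁ : ℝ} (hx : x₁ < x₀) (k : ℝ) :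
    ∃ (c : MeridianCurve) (L : ℝ) (θ : ℝ → ℝ), c.HasCMCFrame l L θ ∧ θ 0 = x₀ ∧ θ 1 = x₁ ∧
      StrictAnti θ ∧ (∀ α, c.r α = nodR l a (θ α)) ∧ (∀ α, c.z α = nodZ l a (θ α) + k) ∧
      ContDiff ℝ ∞ c.r ∧ ContDiff ℝ ∞ c.z := by
  obtain ⟨L, hL, θ, hsm, hanti, h0, h1, hd⟩ := exists_nodary_angle hl ha hx
  refine ⟨⟨fun α => nodR l a (θ α), fun α => nodZ l a (θ α) + k⟩, L, θ, ⟨hL, ?_, ?_, ?_⟩, h0, h1,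
    hanti, fun _ => rfl, fun _ => rfl, (contDiff_nodR hl ha).comp hsm,
    ((contDiff_nodZ hl ha).comp hsm).add contDiff_const⟩
  · intro α _
    -- R' = −cos θ · R/S is chosen to cancel θ_α = −L S/R, leaving r_α = L cos θ.
    have hd' : HasDerivAt (nodR l a) (-(cos (θ α) * nodR l a (θ α) / nodS l a (θ α))) (θ α) := by
      have h1 : HasDerivAt (nodS l a) (sin (θ α) * cos (θ α) / nodS l a (θ α)) (θ α) := by
        have := ((((hasDerivAt_sin (θ α)).fun_pow 2).add_const (4 * l ^ 2 * a ^ 2))).sqrt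
          (nodS_arg_pos hl ha (θ α)).ne'
        refine this.congr_deriv ?_
        change _ / (2 * nodS l a (θ α)) = _
        have := (nodS_pos hl ha (θ α)).ne'
        push_cast
        field_simp
      refine (((hasDerivAt_sin (θ α)).fun_sub h1).div_const (2 * l)).congr_deriv ?_
      have := (nodS_pos hl ha (θ α)).ne'
      have := hl.ne
      rw [nodR]
      field_simp
      ring
    refine (hd'.comp α (hd α)).hasDerivWithinAt.congr_deriv ?_
    have h1 := (nodR_pos hl ha (θ α)).ne'
    have h2 := (nodS_pos hl ha (θ α)).ne'
    field_simp
  · intro α _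
    refine (((hasDerivAt_nodZ hl ha (θ α)).comp α (hd α)).add_const k).hasDerivWithinAt.congr_deriv
      ?_
    have h1 := (nodR_pos hl ha (θ α)).ne'
    have h2 := (nodS_pos hl ha (θ α)).ne'
    field_simp
  · intro α _
    refine (hd α).hasDerivWithinAt.congr_deriv ?_
    rw [two_mul_sub_sin_div_nodR hl ha, mul_neg]

end MeridianCurve

end TwoGrain

namespace TwoGrain

open Set Real

open scoped ContDiff

namespace MeridianCurve

/-! ### Catenaries -/

/-- The catenary of length `L` which leaves the substrate orthogonally at radius `A`. -/
noncomputable def catenary (A L : ℝ) : MeridianCurve where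
  r α := A * √(1 + (L * α / A) ^ 2)
  z α := A * arsinh (L * α / A)

theorem sin_pi_div_two_sub_arctan (x : ℝ) : sin (π / 2 - arctan x) = 1 / √(1 + x ^ 2) := by
  rw [sin_pi_div_two_sub, cos_arctan]

theorem cos_pi_div_two_sub_arctan (x : ℝ) : cos (π / 2 - arctan x) = x / √(1 + x ^ 2) := by
  rw [cos_pi_div_two_sub, sin_arctan]

theorem pi_div_two_sub_arctan_mem (x : ℝ) : π / 2 - arctan x ∈ Ioo 0 π :=
  ⟨by linarith [arctan_lt_pi_div_two x], by linarith [neg_pi_div_two_lt_arctan x]⟩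

/-- In terms of arc length s = L α, the catenary has r² = A² + s² and cot θ = s/A. -/
theorem catenary_hasCMCFrame {A L : ℝ} (hA : 0 < A) (hL : 0 < L) :
    (catenary A L).HasCMCFrame 0 L fun α => π / 2 - arctan (L * α / A) := by
  have hx : ∀ α, HasDerivAt (fun α => L * α / A) (L / A) α := fun α => by
    simpa using ((hasDerivAt_id α).const_mul L).div_const A
  have hp : ∀ x : ℝ, (0 : ℝ) < 1 + x ^ 2 := fun x => by positivity
  refine ⟨hL, fun α _ => ?_, fun α _ => ?_, fun α _ => ?_⟩
  · refine ((((hx α).fun_pow 2).const_add 1).sqrt (hp _).ne').const_mul A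
      |>.hasDerivWithinAt.congr_deriv ?_
    have := (sqrt_pos.2 (hp (L * α / A))).ne'
    rw [cos_pi_div_two_sub_arctan]
    push_cast
    generalize √(1 + (L * α / A) ^ 2) = w at *
    field_simp
  · refine ((hx α).arsinh).const_mul A |>.hasDerivWithinAt.congr_deriv ?_
    have := (sqrt_pos.2 (hp (L * α / A))).ne'
    rw [sin_pi_div_two_sub_arctan, smul_eq_mul]
    generalize √(1 + (L * α / A) ^ 2) = w at *
    field_simp
  · refine ((hx α).arctan).const_sub (π / 2) |>.hasDerivWithinAt.congr_deriv ?_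
    have h1 := (sqrt_pos.2 (hp (L * α / A))).ne'
    have h2 := sq_sqrt (hp (L * α / A)).le
    rw [sin_pi_div_two_sub_arctan]
    simp only [catenary]
    generalize √(1 + (L * α / A) ^ 2) = w at *
    rw [← h2]
    field_simp
    ring

theorem contDiff_catenary_r (A L : ℝ) : ContDiff ℝ ∞ (catenary A L).r :=
  contDiff_const.mul (ContDiff.sqrt (by fun_prop) fun x => by positivity)

theorem contDiff_catenary_z (A L : ℝ) : ContDiff ℝ ∞ (catenary A L).z :=
  contDiff_const.mul (ContDiff.arsinh (by fun_prop))

/-- A minimal surface of revolution meeting the substrate orthogonally is a catenoid. -/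
theorem HasCMCFrame.eq_catenary {c : MeridianCurve} {L : ℝ} {θ : ℝ → ℝ}
    (h : c.HasCMCFrame 0 L θ) (hr : ∀ α ∈ Icc (0 : ℝ) 1, 0 < c.r α) (hz : c.z 0 = 0)
    (h0 : θ 0 = π / 2) (hθ : ∀ α ∈ Icc (0 : ℝ) 1, θ α ∈ Ioc (-π) π) {α : ℝ}
    (hα : α ∈ Icc (0 : ℝ) 1) :
    c.r α = (catenary (c.r 0) L).r α ∧ c.z α = (catenary (c.r 0) L).z α ∧
      θ α = π / 2 - arctan (L * α / c.r 0) := by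
  have m0 : (0 : ℝ) ∈ Icc (0 : ℝ) 1 := left_mem_Icc.2 zero_le_one
  have hA := hr 0 m0
  set A := c.r 0 with hAdef
  have hcat := catenary_hasCMCFrame hA h.pos
  -- For l = 0 the first integral makes r sin θ constantly A, while r cos θ has constant derivative
  -- L. The sum of squares yields r, and the two products then yield the angle.
  have hs : ∀ α ∈ Icc (0 : ℝ) 1, c.r α * sin (θ α) = A := fun α hα => by
    have := h.first_integral hr hα m0
    rw [h0, sin_pi_div_two] at this
    simpa using this
  have hc : ∀ α ∈ Icc (0 : ℝ) 1, c.r α * cos (θ α) = L * α := fun α hα => by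
    have := sub_eq_sub_of_hasDerivWithinAt (f := fun α => c.r α * cos (θ α))
      (g := fun α => L * α) (f' := fun _ => L) (fun α hα => ?_) (fun α hα => ?_) hα m0
    · simp only [h0, cos_pi_div_two] at this
      linarith
    · refine ((h.deriv_r α hα).fun_mul (h.deriv_angle α hα).cos).congr_deriv ?_
      have := (hr α hα).ne'
      field_simp
      linear_combination L * cos_sq_add_sin_sq (θ α)
    · simpa using ((hasDerivAt_id α).const_mul L).hasDerivWithinAt
  have hr' : ∀ α ∈ Icc (0 : ℝ) 1, c.r α = A * √(1 + (L * α / A) ^ 2) := fun α hα => by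
    have h1 : c.r α ^ 2 = (A * √(1 + (L * α / A) ^ 2)) ^ 2 := by
      rw [mul_pow, sq_sqrt (by positivity), mul_add, ← mul_pow, mul_div_cancel₀ _ hA.ne',
        ← hc α hα, mul_one, ← hs α hα]
      linear_combination (-c.r α ^ 2) * cos_sq_add_sin_sq (θ α)
    exact (sq_eq_sq₀ (hr α hα).le (by positivity)).1 h1
  have hang : ∀ α ∈ Icc (0 : ℝ) 1, θ α = π / 2 - arctan (L * α / A) := fun α hα => by
    have hw : 0 < √(1 + (L * α / A) ^ 2) := sqrt_pos.2 (by positivity)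
    have hm := pi_div_two_sub_arctan_mem (L * α / A)
    have e1 := cos_pi_div_two_sub_arctan (L * α / A)
    have e2 := sin_pi_div_two_sub_arctan (L * α / A)
    have h1 := hs α hα
    have h2 := hc α hα
    rw [hr' α hα] at h1 h2
    generalize √(1 + (L * α / A) ^ 2) = w at *
    refine angle_unique (hθ α hα) ⟨by linarith [hm.1, pi_pos], hm.2.le⟩ ?_ ?_
    · rw [e1, div_div, ← h2, mul_assoc, mul_div_mul_left _ _ hA.ne', mul_div_cancel_left₀ _ hw.ne']
    · rw [e2, eq_div_iff hw.ne']
      exact mul_left_cancel₀ hA.ne' (by linarith)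
  refine ⟨hr' α hα, ?_, hang α hα⟩
  have := sub_eq_sub_of_hasDerivWithinAt (f := c.z) (g := (catenary A L).z) h.deriv_z
    (fun α hα => ?_) hα m0
  · have hz' : (catenary A L).z 0 = 0 := by simp [catenary]
    rw [hz, hz'] at this
    linarith
  · rw [hang α hα]
    exact hcat.deriv_z α hα

end MeridianCurve

end TwoGrain

namespace TwoGrain

open Set Real MeridianCurve

/-! ### Necessary conditions for steady states -/

theorem sqrt_sq_add_sq {A : ℝ} (hA : 0 < A) (σ : ℝ) :
    √(σ ^ 2 + A ^ 2) = A * √(1 + (σ / A) ^ 2) := by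
  rw [show σ ^ 2 + A ^ 2 = A ^ 2 * (1 + (σ / A) ^ 2) by field_simp; ring,
    sqrt_mul (by positivity), sqrt_sq hA.le]

/-- For σ ≥ 0 the end angle of the catenary lies in (0, π/2], where arcsin inverts sin. -/
theorem thetabar₁_eq {A σ : ℝ} (hA : 0 < A) (hσ : 0 ≤ σ) (β : ℝ) :
    thetabar₁ A σ β = π / 2 - arctan (σ / A) - β := by
  have h0 : 0 ≤ arctan (σ / A) := arctan_nonneg.2 (by positivity)
  have hm := pi_div_two_sub_arctan_mem (σ / A)
  rw [thetabar₁, sqrt_sq_add_sq hA, ← div_div, div_self hA.ne', ← sin_pi_div_two_sub_arctan,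
    arcsin_sin (by linarith [hm.1]) (by linarith)]

/-- Since cosh (arsinh x) = √(1 + x²), arcosh can be traded for arsinh, which stays smooth at σ = 0.
-/
theorem zbar_eq {A σ : ℝ} (hA : 0 < A) (hσ : 0 ≤ σ) : zbar A σ = A * arsinh (σ / A) := by
  rw [zbar, sqrt_sq_add_sq hA, mul_div_cancel_left₀ _ hA.ne', ← cosh_arsinh,
    arcosh_cosh (arsinh_nonneg_iff.2 (by positivity))]

theorem catenary_r_one_sq {A : ℝ} (hA : 0 < A) (σ : ℝ) :
    (catenary A σ).r 1 ^ 2 = A ^ 2 + σ ^ 2 := by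
  simp only [catenary, mul_one]
  rw [mul_pow, sq_sqrt (by positivity)]
  field_simp

/-- Together with its cosine counterpart, this makes ρ sin(φ ± β) at the junction linear in A and σ.
-/
theorem catenary_r_mul_sin (A σ : ℝ) :
    (catenary A σ).r 1 * sin (π / 2 - arctan (σ / A)) = A := by
  have : 0 < √(1 + (σ / A) ^ 2) := sqrt_pos.2 (by positivity)
  rw [sin_pi_div_two_sub_arctan]
  simp only [catenary, mul_one]
  rw [mul_assoc, mul_one_div_cancel this.ne', mul_one]

theorem catenary_r_mul_cos {A : ℝ} (hA : 0 < A) (σ : ℝ) :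
    (catenary A σ).r 1 * cos (π / 2 - arctan (σ / A)) = σ := by
  have : 0 < √(1 + (σ / A) ^ 2) := sqrt_pos.2 (by positivity)
  rw [cos_pi_div_two_sub_arctan]
  simp only [catenary, mul_one]
  rw [mul_assoc, mul_div_cancel₀ _ this.ne', mul_div_cancel₀ _ hA.ne']

theorem catenary_z_one {A σ : ℝ} (hA : 0 < A) (hσ : 0 ≤ σ) :
    (catenary A σ).z 1 = zbar A σ := by
  rw [zbar_eq hA hσ]
  simp [catenary]

theorem z₁_eq_nodZ {A σ β : ℝ} (hl : lam A σ β < 0) (ha : 0 < aell A σ β) (θ : ℝ) :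
    z₁ A σ β θ = nodZ (lam A σ β) (aell A σ β) θ
      - nodZ (lam A σ β) (aell A σ β) (thetabar₁ A σ β) + zbar A σ := by
  have hc := (contDiff_nodZ_integrand hl ha).continuous
  rw [z₁, nodZ, nodZ, ← mul_sub, intervalIntegral.integral_interval_sub_left
    (hc.intervalIntegrable _ _) (hc.intervalIntegrable _ _)]
  rfl

namespace Profile.IsSteadyState

variable {β : ℝ} {P Q : Profile}

theorem r₂_pos {θc : ℝ} (h : P.IsSteadyState β θc) : ∀ α ∈ Icc (0 : ℝ) 1, 0 < P.Γ₂.r α := by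
  intro α hα
  rcases hα.2.lt_or_eq with h1 | h1
  · exact (h.r₂_mem α ⟨hα.1, h1⟩).1
  · rw [h1, h.wall₂]
    exact one_pos

/-- The three curves of a steady state: a catenary and two curves with the same constant mean
curvature. -/
theorem exists_frames {θc : ℝ} (h : P.IsSteadyState β θc) :
    ∃ (l L₁ L₂ : ℝ) (θ₁ θ₂ : ℝ → ℝ), P.Γ₁.HasCMCFrame l L₁ θ₁ ∧ P.Γ₂.HasCMCFrame l L₂ θ₂ ∧
      0 < P.Γ₃.arcLength ∧ θ₁ 0 = θc ∧
      θ₁ 1 = π / 2 - arctan (P.Γ₃.arcLength / P.Γ₃.r 0) - β ∧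
      θ₂ 0 = π / 2 - arctan (P.Γ₃.arcLength / P.Γ₃.r 0) - π + β ∧ θ₂ 1 = 0 ∧
      EqOn P.Γ₃.point (catenary (P.Γ₃.r 0) P.Γ₃.arcLength).point (Icc 0 1) := by
  obtain ⟨θ₁, θ₂, θ₃, hθ₁, hθ₂, hθ₃, e1, e2, e3, e4, e5⟩ := h.angles
  have m0 : (0 : ℝ) ∈ Icc (0 : ℝ) 1 := left_mem_Icc.2 zero_le_one
  have m1 : (1 : ℝ) ∈ Icc (0 : ℝ) 1 := right_mem_Icc.2 zero_le_one
  have hr₁ : ∀ α ∈ Icc (0 : ℝ) 1, 0 < P.Γ₁.r α := fun α hα => (h.r₁_mem α hα).1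
  have hr₃ : ∀ α ∈ Icc (0 : ℝ) 1, 0 < P.Γ₃.r α := fun α hα => (h.r₃_mem α hα).1
  obtain ⟨L₁, f₁⟩ := h.regular₁.exists_hasFrame hθ₁ hr₁
  obtain ⟨L₂, f₂⟩ := h.regular₂.exists_hasFrame hθ₂ h.r₂_pos
  obtain ⟨L₃, f₃⟩ := h.regular₃.exists_hasFrame hθ₃ hr₃
  have H₃ : ∀ α ∈ Icc (0 : ℝ) 1, P.Γ₃.meanCurv α = 0 := fun α hα => by
    -- H = 0 is assumed only in the open interval; continuity of H carries it to the end points.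
    have hcl : Icc (0 : ℝ) 1 ⊆ closure (Ioo 0 1) := by rw [closure_Ioo zero_ne_one]
    exact EqOn.of_subset_closure (g := fun _ => 0) h.mean_curvature₃
      (h.regular₃.contDiffOn_meanCurv hθ₃ hr₃).continuousOn continuousOn_const
      Ioo_subset_Icc_self hcl hα
  have g₃ : P.Γ₃.HasCMCFrame 0 L₃ θ₃ := f₃.congr fun α hα => by simp only [H₃ α hα]
  have hσ := f₃.arcLength_eq
  have hcat := fun (α : ℝ) (hα : α ∈ Icc (0 : ℝ) 1) =>
    g₃.eq_catenary hr₃ h.foot₃ e3 (fun α hα => (hθ₃.2 α hα).1) hα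
  rw [hσ]
  have hφ := (hcat 1 m1).2.2
  rw [mul_one] at hφ
  refine ⟨P.Γ₁.meanCurv 1, L₁, L₂, θ₁, θ₂, f₁.congr fun α hα => ?_, f₂.congr fun α hα => ?_,
    f₃.pos, e1, by linarith, by linarith, e2, fun α hα => ?_⟩
  · simp only [h.regular₁.meanCurv_const hθ₁ hr₁ h.surface_diffusion₁ m0 h.flux_foot₁ hα m1]
  · simp only [h.chemical_potential, h.regular₂.meanCurv_const hθ₂ h.r₂_pos h.surface_diffusion₂ m1
      h.flux_wall₂ hα m0]
  · exact Prod.ext (hcat α hα).1 (hcat α hα).2.1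

/-- The catenary ends at radius √(A² + σ²), which must be below 1. -/
theorem params_mem {θc : ℝ} (h : P.IsSteadyState β θc) : P.params ∈ Ω₀ := by
  obtain ⟨-, -, -, -, -, -, -, hσ, -, -, -, -, hcat⟩ := h.exists_frames
  have m0 : (0 : ℝ) ∈ Icc (0 : ℝ) 1 := left_mem_Icc.2 zero_le_one
  have m1 : (1 : ℝ) ∈ Icc (0 : ℝ) 1 := right_mem_Icc.2 zero_le_one
  have hA := h.r₃_mem 0 m0
  have h1 := h.r₃_mem 1 m1
  have hr : P.Γ₃.r 1 = (catenary (P.Γ₃.r 0) P.Γ₃.arcLength).r 1 := congrArg Prod.fst (hcat m1)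
  have hsq := catenary_r_one_sq hA.1 P.Γ₃.arcLength
  rw [← hr] at hsq
  refine ⟨hA.1, hA.2, hσ, lt_sqrt_of_sq_lt ?_⟩
  change P.Γ₃.arcLength ^ 2 < 1 - P.Γ₃.r 0 ^ 2
  nlinarith [h1.1, h1.2]

/-- The exterior surfaces of a steady state are pieces of nodaries determined by the parameters. -/
theorem exists_nodary_frames (h : P.IsSteadyState β π) {A σ : ℝ} (hp : P.params = (A, σ))
    (hneg : A * cos β + σ * sin β < 0) :
    lam A σ β < 0 ∧ 0 < aell A σ β ∧ ∃ (L₁ L₂ : ℝ) (θ₁ θ₂ : ℝ → ℝ),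
      P.Γ₁.HasCMCFrame (lam A σ β) L₁ θ₁ ∧ P.Γ₂.HasCMCFrame (lam A σ β) L₂ θ₂ ∧
      (∀ α ∈ Icc (0 : ℝ) 1, P.Γ₁.r α = nodR (lam A σ β) (aell A σ β) (θ₁ α)) ∧
      (∀ α ∈ Icc (0 : ℝ) 1, P.Γ₂.r α = nodR (lam A σ β) 1 (θ₂ α)) ∧
      θ₁ 0 = π ∧ θ₁ 1 = thetabar₁ A σ β ∧ θ₂ 0 = π / 2 - arctan (σ / A) - π + β ∧ θ₂ 1 = 0 ∧
      P.Γ₁.z 1 = zbar A σ ∧ P.Γ₂.z 0 = zbar A σ ∧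
      EqOn P.Γ₃.point (catenary A σ).point (Icc 0 1) := by
  obtain ⟨l, L₁, L₂, θ₁, θ₂, f₁, f₂, hσ, e1, e2, e3, e4, hcat⟩ := h.exists_frames
  have hmem := h.params_mem
  have hA' : P.Γ₃.r 0 = A := congrArg Prod.fst hp
  have hσ' : P.Γ₃.arcLength = σ := congrArg Prod.snd hp
  rw [hp] at hmem
  rw [hA', hσ'] at e2 e3 hcat
  rw [hσ'] at hσ
  have m0 : (0 : ℝ) ∈ Icc (0 : ℝ) 1 := left_mem_Icc.2 zero_le_one
  have m1 : (1 : ℝ) ∈ Icc (0 : ℝ) 1 := right_mem_Icc.2 zero_le_one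
  have hA : 0 < A := hmem.1
  have hr₁ : ∀ α ∈ Icc (0 : ℝ) 1, 0 < P.Γ₁.r α := fun α hα => (h.r₁_mem α hα).1
  have j1 : (catenary A σ).point 1 = P.Γ₂.point 0 := by rw [← hcat m1, h.junction₃₂]
  have j2 : P.Γ₁.point 1 = (catenary A σ).point 1 := by rw [j1, h.junction₁₂]
  have hr2 : P.Γ₂.r 0 = (catenary A σ).r 1 := congrArg Prod.fst j1.symm
  have hr1 : P.Γ₁.r 1 = (catenary A σ).r 1 := congrArg Prod.fst j2
  have hz2 : P.Γ₂.z 0 = (catenary A σ).z 1 := congrArg Prod.snd j1.symm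
  have hz1 : P.Γ₁.z 1 = (catenary A σ).z 1 := congrArg Prod.snd j2
  rw [catenary_z_one hA hσ.le] at hz1 hz2
  have hD : 0 < 1 - A ^ 2 - σ ^ 2 := by
    have := (lt_sqrt hσ.le).1 hmem.2.2.2
    linarith
  have cs := catenary_r_mul_sin A σ
  have cc := catenary_r_mul_cos hA σ
  have csq := catenary_r_one_sq hA σ
  -- Junction to wall determines l from Γ₂; junction to foot, where sin π = 0, then determines the
  -- foot radius from Γ₁.
  have i2 := f₂.first_integral h.r₂_pos m0 m1
  have i1 := f₁.first_integral hr₁ m1 m0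
  rw [e3, e4, h.wall₂, hr2] at i2
  rw [e1, e2, hr1, sin_pi] at i1
  rw [thetabar₁_eq hA hσ.le]
  generalize π / 2 - arctan (σ / A) = φ at *
  rw [show φ - π + β = (φ + β) - π by ring, sin_sub_pi, sin_add, csq, sin_zero] at i2
  rw [sin_sub, csq] at i1
  have hl : l * (1 - A ^ 2 - σ ^ 2) = A * cos β + σ * sin β := by
    linear_combination i2 + cos β * cs + sin β * cc
  have hlam : lam A σ β = l := by rw [lam, ← hl, mul_div_cancel_right₀ _ hD.ne']
  have hl0 : l < 0 := by
    by_contra hcon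
    have : 0 ≤ l * (1 - A ^ 2 - σ ^ 2) := mul_nonneg (not_lt.1 hcon) hD.le
    linarith
  have ha0 := hr₁ 0 m0
  have hla : l * P.Γ₁.r 0 ^ 2 = l * (A ^ 2 + σ ^ 2) - (A * cos β - σ * sin β) := by
    linear_combination i1 - cos β * cs + sin β * cc
  have hell : aell A σ β = P.Γ₁.r 0 := by
    rw [aell, show ((2 * A ^ 2 + 2 * σ ^ 2 - 1) * A * cos β + σ * sin β) /
      (A * cos β + σ * sin β) = P.Γ₁.r 0 ^ 2 from ?_, sqrt_sq ha0.le]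
    rw [div_eq_iff hneg.ne, ← hl]
    linear_combination (-(1 - A ^ 2 - σ ^ 2)) * hla - (A ^ 2 + σ ^ 2) * hl
  rw [hlam, hell]
  refine ⟨hl0, ha0, L₁, L₂, θ₁, θ₂, f₁, f₂, fun α hα => ?_, fun α hα => ?_, e1, e2, e3, e4, hz1,
    hz2, hcat⟩
  · exact f₁.r_eq_nodR hr₁ hl0 ha0 m0 (by rw [e1, sin_pi]; ring) hα
  · exact f₂.r_eq_nodR h.r₂_pos hl0 one_pos m1 (by rw [e4, sin_zero, h.wall₂]; ring) hα

/-- The nodary of Γ₁, followed from the junction to tangent angle π, ends at the foot, which lies on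
the substrate. -/
theorem z₁_pi_eq_zero (h : P.IsSteadyState β π) {A σ : ℝ} (hp : P.params = (A, σ))
    (hneg : A * cos β + σ * sin β < 0) : z₁ A σ β π = 0 := by
  obtain ⟨hl, ha, L₁, L₂, θ₁, θ₂, f₁, -, hR, -, e0, e1, -, -, hz, -⟩ :=
    h.exists_nodary_frames hp hneg
  have := f₁.z_sub_nodZ hl ha hR (left_mem_Icc.2 zero_le_one) (right_mem_Icc.2 zero_le_one)
  rw [h.foot₁, hz, e0, e1] at this
  rw [z₁_eq_nodZ hl ha]
  linarith

/-- Steady states are determined by their parameters. -/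
theorem same (h : P.IsSteadyState β π) (h' : Q.IsSteadyState β π) {A σ : ℝ}
    (hp : P.params = (A, σ)) (hq : Q.params = (A, σ)) (hneg : A * cos β + σ * sin β < 0) :
    P.Same Q := by
  obtain ⟨hl, ha, L₁, L₂, θ₁, θ₂, f₁, f₂, hR₁, hR₂, a0, a1, b0, b1, c1, c2, hc⟩ :=
    h.exists_nodary_frames hp hneg
  obtain ⟨-, -, L₁', L₂', θ₁', θ₂', f₁', f₂', hR₁', hR₂', a0', a1', b0', b1', c1', c2', hc'⟩ :=
    h'.exists_nodary_frames hq hneg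
  refine ⟨?_, ?_, hc.trans hc'.symm⟩
  · exact f₁.eqOn_point f₁' hl ha hR₁ hR₁' (a0.trans a0'.symm) (a1.trans a1'.symm)
      (right_mem_Icc.2 zero_le_one) (c1.trans c1'.symm)
  · exact f₂.eqOn_point f₂' hl one_pos hR₂ hR₂' (b0.trans b0'.symm) (b1.trans b1'.symm)
      (left_mem_Icc.2 zero_le_one) (c2.trans c2'.symm)

end Profile.IsSteadyState

end TwoGrain

namespace TwoGrain

open Set Real MeridianCurve

open scoped ContDiff

/-! ### Geometry of the nodary -/

section Geometry

variable {l a : ℝ}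

/-- For l < 0, sin θ = l (R − a²/R) is strictly decreasing in R > 0. All comparisons of radii along
the curves reduce to comparisons of sines. -/
theorem nodR_lt_of_sin_lt (hl : l < 0) (ha : 0 < a) {x y : ℝ} (h : sin x < sin y) :
    nodR l a y < nodR l a x := by
  have hx := nodR_pos hl ha x
  have hy := nodR_pos hl ha y
  have ex := nodR_mul_sin hl a x
  have ey := nodR_mul_sin hl a y
  have h1 : (sin y - sin x) * (nodR l a x * nodR l a y)
      = -l * (nodR l a x * nodR l a y + a ^ 2) * (nodR l a x - nodR l a y) := by
    linear_combination nodR l a x * ey - nodR l a y * ex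
  have h2 : 0 < (sin y - sin x) * (nodR l a x * nodR l a y) :=
    mul_pos (sub_pos.2 h) (mul_pos hx hy)
  rw [h1] at h2
  have h3 : 0 < -l * (nodR l a x * nodR l a y + a ^ 2) :=
    mul_pos (by linarith) (by positivity)
  linarith [pos_of_mul_pos_right h2 h3.le]

theorem nodR_of_sin_eq (l a : ℝ) {x y : ℝ} (h : sin x = sin y) : nodR l a x = nodR l a y := by
  simp only [nodR, nodS, h]

theorem nodR_le_of_sin_le (hl : l < 0) (ha : 0 < a) {x y : ℝ} (h : sin x ≤ sin y) :
    nodR l a y ≤ nodR l a x :=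
  h.lt_or_eq.elim (fun h => (nodR_lt_of_sin_lt hl ha h).le) fun h => (nodR_of_sin_eq l a h).ge

theorem nodR_zero (hl : l < 0) (ha : 0 < a) : nodR l a 0 = a :=
  (eq_nodR hl ha ha (by simp)).symm

/-- The derivative of `nodZ` has the sign of −sin, so the height peaks at tangent angle 0. -/
theorem nodZ_strictAntiOn (hl : l < 0) (ha : 0 < a) : StrictAntiOn (nodZ l a) (Icc 0 π) := by
  refine strictAntiOn_of_deriv_neg (convex_Icc _ _)
    (contDiff_nodZ hl ha).continuous.continuousOn fun x hx => ?_
  rw [interior_Icc] at hx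
  rw [(hasDerivAt_nodZ hl ha x).deriv, neg_lt_zero]
  exact div_pos (mul_pos (sin_pos_of_mem_Ioo hx) (nodR_pos hl ha x)) (nodS_pos hl ha x)

theorem nodZ_strictMonoOn (hl : l < 0) (ha : 0 < a) : StrictMonoOn (nodZ l a) (Icc (-π) 0) := by
  refine strictMonoOn_of_deriv_pos (convex_Icc _ _)
    (contDiff_nodZ hl ha).continuous.continuousOn fun x hx => ?_
  rw [interior_Icc] at hx
  rw [(hasDerivAt_nodZ hl ha x).deriv, neg_pos]
  exact div_neg_of_neg_of_pos
    (mul_neg_of_neg_of_pos (sin_neg_of_neg_of_neg_pi_lt hx.2 hx.1) (nodR_pos hl ha x))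
    (nodS_pos hl ha x)

/-- The nodary does not intersect itself on the range `[-π/2, π]` of tangent angles. -/
theorem nodary_injOn (hl : l < 0) (ha : 0 < a) :
    InjOn (fun x => (nodR l a x, nodZ l a x)) (Icc (-(π / 2)) π) := by
  intro x hx y hy hxy
  obtain ⟨hR, hZ⟩ := Prod.mk.inj hxy
  have hs : sin x = sin y := by
    rcases lt_trichotomy (sin x) (sin y) with h | h | h
    · exact absurd hR (nodR_lt_of_sin_lt hl ha h).ne'
    · exact h
    · exact absurd hR (nodR_lt_of_sin_lt hl ha h).ne
  have neg_iff : ∀ t ∈ Icc (-(π / 2)) π, t < 0 ↔ sin t < 0 := fun t ht =>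
    ⟨fun h => sin_neg_of_neg_of_neg_pi_lt h (by linarith [ht.1, pi_pos]),
      fun h => not_le.1 fun h0 => h.not_ge (sin_nonneg_of_nonneg_of_le_pi h0 ht.2)⟩
  -- Equal sines put both angles on the same side of 0: on [−π/2, 0] sine is injective, on [0, π]
  -- the height is.
  rcases lt_or_ge (sin x) 0 with h | h
  · have hx0 := (neg_iff x hx).2 h
    have hy0 := (neg_iff y hy).2 (hs ▸ h)
    exact injOn_sin ⟨hx.1, by linarith [pi_pos]⟩ ⟨hy.1, by linarith [pi_pos]⟩ hs
  · have hx0 := not_lt.1 ((neg_iff x hx).not.2 h.not_gt)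
    have hy0 := not_lt.1 ((neg_iff y hy).not.2 (hs ▸ h).not_gt)
    exact (nodZ_strictAntiOn hl ha).injOn ⟨hx0, hx.2⟩ ⟨hy0, hy.2⟩ hZ

end Geometry

/-! ### Stationarity and regularity of the constant mean curvature pieces -/

namespace MeridianCurve

theorem HasCMCFrame.dα_meanCurv {c : MeridianCurve} {l L : ℝ} {θ : ℝ → ℝ}
    (h : c.HasCMCFrame l L θ) {α : ℝ} (hα : α ∈ Icc (0 : ℝ) 1) : dα c.meanCurv α = 0 := by
  rw [dα_congr (g := fun _ => l) (fun a ha => h.meanCurv_eq ha) hα]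
  exact dα_eq (hasDerivWithinAt_const _ _ _) hα

theorem HasCMCFrame.surface_diffusion {c : MeridianCurve} {l L : ℝ} {θ : ℝ → ℝ}
    (h : c.HasCMCFrame l L θ) {α : ℝ} (hα : α ∈ Icc (0 : ℝ) 1) :
    dα (fun a => c.r a * dα c.meanCurv a) α = 0 := by
  rw [dα_congr (g := fun _ => 0) (fun a ha => by rw [h.dα_meanCurv ha, mul_zero]) hα]
  exact dα_eq (hasDerivWithinAt_const _ _ _) hα

theorem HasFrame.isRegular {c : MeridianCurve} {L : ℝ} {θ κ : ℝ → ℝ} (h : c.HasFrame L θ κ)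
    (hr : ContDiff ℝ ∞ c.r) (hz : ContDiff ℝ ∞ c.z) (hinj : InjOn c.point (Icc 0 1)) :
    c.IsRegular :=
  ⟨(contDiff_infty.1 hr 4).contDiffOn, (contDiff_infty.1 hz 4).contDiffOn, fun _ hα => h.equidistributed hα, hinj⟩

theorem catenary_r_strictMonoOn {A σ : ℝ} (hA : 0 < A) (hσ : 0 < σ) :
    StrictMonoOn (catenary A σ).r (Icc 0 1) := by
  intro x hx y hy hxy
  have hx0 := hx.1
  have h1 : σ * x / A < σ * y / A := by gcongr
  have h2 : 0 ≤ σ * x / A := by positivity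
  simp only [catenary]
  gcongr

theorem catenary_z_strictMono {A σ : ℝ} (hA : 0 < A) (hσ : 0 < σ) :
    StrictMono (catenary A σ).z := by
  intro x y hxy
  simp only [catenary]
  refine mul_lt_mul_of_pos_left (arsinh_lt_arsinh.2 ?_) hA
  gcongr

end MeridianCurve

/-! ### Construction of steady states -/

/-- The two bounds on arctan(σ/A) place the junction angles x₁ of Γ₁ in (−π/2, 0) and x₂ of Γ₂ in
(0, π/2). There radii are monotone in the angle, so away from the junction Γ₁ stays inside the
junction radius ρ and Γ₂ outside it. The condition `aell` < A orders the feet and helps keep Γ₁ off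
Γ₃; z₁(π) = 0 joins the foot of Γ₁ to its junction end. -/
theorem exists_steadyState {β A σ : ℝ} (hmem : (A, σ) ∈ Ω₀)
    (hneg : A * cos β + σ * sin β < 0)
    (hneg' : (2 * A ^ 2 + 2 * σ ^ 2 - 1) * A * cos β + σ * sin β < 0)
    (hτ : arctan (σ / A) < β - π / 2) (hτ' : arctan (σ / A) < π - β) (haA : aell A σ β < A)
    (hz : z₁ A σ β π = 0) :
    ∃ P : Profile, P.IsSteadyState β π ∧ P.params = (A, σ) := by
  have hA : 0 < A := hmem.1
  have hσ : 0 < σ := hmem.2.2.1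
  have m0 : (0 : ℝ) ∈ Icc (0 : ℝ) 1 := left_mem_Icc.2 zero_le_one
  have m1 : (1 : ℝ) ∈ Icc (0 : ℝ) 1 := right_mem_Icc.2 zero_le_one
  have hπ := pi_pos
  have hτ0 : 0 < arctan (σ / A) := arctan_pos.2 (by positivity)
  have hD : 0 < 1 - A ^ 2 - σ ^ 2 := by
    have := (lt_sqrt hσ.le).1 hmem.2.2.2
    linarith
  have hl : lam A σ β < 0 := div_neg_of_neg_of_pos hneg hD
  have ha : 0 < aell A σ β := sqrt_pos.2 (div_pos_of_neg_of_neg hneg' hneg)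
  have hasq : aell A σ β ^ 2 * (A * cos β + σ * sin β)
      = (2 * A ^ 2 + 2 * σ ^ 2 - 1) * A * cos β + σ * sin β := by
    rw [aell, sq_sqrt (div_pos_of_neg_of_neg hneg' hneg).le, div_mul_cancel₀ _ hneg.ne]
  have hlD : lam A σ β * (1 - A ^ 2 - σ ^ 2) = A * cos β + σ * sin β := by
    rw [lam, div_mul_cancel₀ _ hD.ne']
  have hbar := z₁_eq_nodZ hl ha π
  rw [hz] at hbar
  have hzb : (catenary A σ).z 1 = zbar A σ := catenary_z_one hA hσ.le
  have hzpos : 0 < zbar A σ := by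
    rw [zbar_eq hA hσ.le]
    exact mul_pos hA (arsinh_pos_iff.2 (by positivity))
  have htb := thetabar₁_eq hA hσ.le β
  generalize lam A σ β = l at *
  generalize aell A σ β = a at *
  generalize hx₁ : thetabar₁ A σ β = x₁ at *
  have hx₁0 : x₁ < 0 := by linarith
  have hx₁1 : -(π / 2) < x₁ := by linarith
  set x₂ := π / 2 - arctan (σ / A) - π + β with hx₂
  have hx₂0 : 0 < x₂ := by linarith
  have hx₂1 : x₂ < π / 2 := by linarith
  have f₃ := catenary_hasCMCFrame hA hσ
  set ρ := (catenary A σ).r 1 with hρ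
  have csq : ρ ^ 2 = A ^ 2 + σ ^ 2 := catenary_r_one_sq hA σ
  have cs : ρ * sin (π / 2 - arctan (σ / A)) = A := catenary_r_mul_sin A σ
  have cc : ρ * cos (π / 2 - arctan (σ / A)) = σ := catenary_r_mul_cos hA σ
  have hr3mono := catenary_r_strictMonoOn hA hσ
  have hz3mono := catenary_z_strictMono hA hσ
  have hA3 : (catenary A σ).r 0 = A := by simp [catenary]
  have hz30 : (catenary A σ).z 0 = 0 := by simp [catenary]
  have hρA : A ≤ ρ := hA3 ▸ hr3mono.monotoneOn m0 m1 zero_le_one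
  have hρ0 : 0 < ρ := hA.trans_le hρA
  have hρ1 : ρ < 1 := by nlinarith
  -- The values of l and a are those for which both nodaries reach radius ρ at their junction
  -- angles.
  have hr1 : nodR l a x₁ = ρ := by
    refine (eq_nodR hl ha hρ0 ?_).symm
    rw [htb, sin_sub, csq]
    refine mul_right_cancel₀ hD.ne' ?_
    have key : l * (A ^ 2 + σ ^ 2 - a ^ 2) * (1 - A ^ 2 - σ ^ 2)
        = (A ^ 2 + σ ^ 2) * (A * cos β + σ * sin β)
          - ((2 * A ^ 2 + 2 * σ ^ 2 - 1) * A * cos β + σ * sin β) := by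
      linear_combination (A ^ 2 + σ ^ 2 - a ^ 2) * hlD - hasq
    rw [key]
    linear_combination (1 - A ^ 2 - σ ^ 2) * (cos β * cs - sin β * cc)
  have hr2 : nodR l 1 x₂ = ρ := by
    refine (eq_nodR hl one_pos hρ0 ?_).symm
    rw [hx₂, show π / 2 - arctan (σ / A) - π + β = (π / 2 - arctan (σ / A) + β) - π by ring,
      sin_sub_pi, sin_add, csq]
    linear_combination hlD - cos β * cs - sin β * cc
  -- The shift puts the foot at height 0; the junction height `zbar` then comes from `hz`.
  obtain ⟨c₁, L₁, θ₁, f₁, a0, a1, anti₁, hR₁, hZ₁, hs₁, hs₁'⟩ :=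
    exists_nodary hl ha (show x₁ < π by linarith) (-nodZ l a π)
  obtain ⟨c₂, L₂, θ₂, f₂, b0, b1, anti₂, hR₂, hZ₂, hs₂, hs₂'⟩ :=
    exists_nodary hl one_pos hx₂0 (zbar A σ - nodZ l 1 x₂)
  have ang₁ : ∀ α ∈ Icc (0 : ℝ) 1, x₁ ≤ θ₁ α ∧ θ₁ α ≤ π := fun α hα =>
    ⟨a1 ▸ anti₁.antitone hα.2, a0 ▸ anti₁.antitone hα.1⟩
  have ang₂ : ∀ α ∈ Icc (0 : ℝ) 1, 0 ≤ θ₂ α ∧ θ₂ α ≤ x₂ := fun α hα =>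
    ⟨b1 ▸ anti₂.antitone hα.2, b0 ▸ anti₂.antitone hα.1⟩
  have p1 : c₁.point 1 = c₂.point 0 := by
    refine Prod.ext ?_ ?_
    · change c₁.r 1 = c₂.r 0
      rw [hR₁, hR₂, a1, b0, hr1, hr2]
    · change c₁.z 1 = c₂.z 0
      rw [hZ₁, hZ₂, a1, b0]
      linarith
  have p3 : (catenary A σ).point 1 = c₂.point 0 := by
    refine Prod.ext ?_ ?_
    · change (catenary A σ).r 1 = c₂.r 0
      rw [hR₂, b0, hr2]
    · change (catenary A σ).z 1 = c₂.z 0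
      rw [hZ₂, b0, hzb]
      ring
  -- position of the curves relative to the junction
  have lt₁ : ∀ α ∈ Ico (0 : ℝ) 1, c₁.r α < ρ := fun α hα => by
    rw [hR₁, ← hr1]
    refine nodR_lt_of_sin_lt hl ha ?_
    have h1 : x₁ < θ₁ α := a1 ▸ anti₁ hα.2
    have h2 := (ang₁ α (Ico_subset_Icc_self hα)).2
    rcases le_or_gt (θ₁ α) 0 with h | h
    · exact sin_lt_sin_of_lt_of_le_pi_div_two hx₁1.le (by linarith) h1
    · exact (sin_neg_of_neg_of_neg_pi_lt hx₁0 (by linarith)).trans_le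
        (sin_nonneg_of_nonneg_of_le_pi h.le h2)
  have lt₂ : ∀ α ∈ Ioc (0 : ℝ) 1, ρ < c₂.r α := fun α hα => by
    rw [hR₂, ← hr2]
    refine nodR_lt_of_sin_lt hl one_pos ?_
    have h1 : θ₂ α < x₂ := b0 ▸ anti₂ hα.1
    have h2 := (ang₂ α (Ioc_subset_Icc_self hα)).1
    exact sin_lt_sin_of_lt_of_le_pi_div_two (by linarith) hx₂1.le h1
  have e₁ : c₁.r 1 = ρ := by rw [hR₁, a1, hr1]
  have e₂ : c₂.r 0 = ρ := by rw [hR₂, b0, hr2]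
  have le₁ : ∀ α ∈ Icc (0 : ℝ) 1, c₁.r α ≤ ρ := fun α hα =>
    hα.2.lt_or_eq.elim (fun h => (lt₁ α ⟨hα.1, h⟩).le) fun h => h ▸ e₁.le
  have le₂ : ∀ α ∈ Icc (0 : ℝ) 1, ρ ≤ c₂.r α := fun α hα =>
    hα.1.lt_or_eq.elim (fun h => (lt₂ α ⟨h, hα.2⟩).le) fun h => h ▸ e₂.ge
  have le₃ : ∀ α ∈ Icc (0 : ℝ) 1, (catenary A σ).r α ≤ ρ := fun α hα =>
    hr3mono.monotoneOn hα m1 hα.2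
  have ge₃ : ∀ α ∈ Icc (0 : ℝ) 1, A ≤ (catenary A σ).r α := fun α hα =>
    hA3.symm.le.trans (hr3mono.monotoneOn m0 hα hα.1)
  have zpos₁ : ∀ α ∈ Ico (0 : ℝ) 1, θ₁ α < 0 → zbar A σ < c₁.z α := fun α hα h => by
    have h1 : x₁ < θ₁ α := a1 ▸ anti₁ hα.2
    have := nodZ_strictMonoOn hl ha ⟨by linarith, hx₁0.le⟩ ⟨by linarith, h.le⟩ h1
    rw [hZ₁]
    linarith
  have z1one : c₁.z 1 = zbar A σ := by
    rw [hZ₁, a1]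
    linarith
  have hwall : c₂.r 1 = 1 := by rw [hR₂, b1, nodR_zero hl one_pos]
  refine ⟨⟨c₁, c₂, catenary A σ⟩, ?_, Prod.ext hA3 (HasFrame.arcLength_eq f₃)⟩
  refine
    { regular₁ := f₁.isRegular hs₁ hs₁' ?_
      regular₂ := f₂.isRegular hs₂ hs₂' ?_
      regular₃ := f₃.isRegular (contDiff_catenary_r A σ) (contDiff_catenary_z A σ) ?_
      surface_diffusion₁ := fun α hα => f₁.surface_diffusion (Ioo_subset_Icc_self hα)
      surface_diffusion₂ := fun α hα => f₂.surface_diffusion (Ioo_subset_Icc_self hα)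
      mean_curvature₃ := fun α hα => f₃.meanCurv_eq (Ioo_subset_Icc_self hα)
      foot₁ := ?_
      foot₃ := hz30
      wall₂ := hwall
      junction₁₂ := p1
      junction₃₂ := p3
      feet_order := ?_
      angles := ?_
      chemical_potential := ?_
      flux_foot₁ := f₁.dα_meanCurv m0
      flux_junction := ?_
      flux_wall₂ := f₂.dα_meanCurv m1
      r₁_mem := fun α hα => ⟨?_, (le₁ α hα).trans_lt hρ1⟩
      r₂_mem := fun α hα => ⟨?_, ?_⟩
      r₃_mem := fun α hα => ⟨hA.trans_le (ge₃ α hα), (le₃ α hα).trans_lt hρ1⟩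
      z₁_pos := fun α hα => ?_
      z₂_pos := fun α hα => ?_
      z₃_pos := fun α hα => hz30 ▸ hz3mono hα.1
      inter₁₂ := ?_
      inter₁₃ := ?_
      inter₂₃ := ?_ }
  · intro α hα α' hα' h
    have h' := Prod.mk.inj h
    rw [hR₁, hR₁, hZ₁, hZ₁] at h'
    refine anti₁.injective (nodary_injOn hl ha
      ⟨hx₁1.le.trans (ang₁ α hα).1, (ang₁ α hα).2⟩
      ⟨hx₁1.le.trans (ang₁ α' hα').1, (ang₁ α' hα').2⟩ (Prod.ext h'.1 (add_right_cancel h'.2)))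
  · intro α hα α' hα' h
    have h' := Prod.mk.inj h
    rw [hR₂, hR₂, hZ₂, hZ₂] at h'
    have h1 := ang₂ α hα
    have h2 := ang₂ α' hα'
    refine anti₂.injective (nodary_injOn hl one_pos ⟨by linarith, by linarith⟩
      ⟨by linarith, by linarith⟩ (Prod.ext h'.1 (add_right_cancel h'.2)))
  · intro α hα α' hα' h
    exact hr3mono.injOn hα hα' (Prod.mk.inj h).1
  · change c₁.z 0 = 0
    rw [hZ₁, a0, add_neg_cancel]
  · change c₁.r 0 < (catenary A σ).r 0
    rw [hR₁, a0, hA3, nodR_of_sin_eq l a (y := 0) (by simp), nodR_zero hl ha]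
    exact haA
  · refine ⟨θ₁, θ₂, fun α => π / 2 - arctan (σ * α / A), f₁.isAngle fun α hα => ?_,
      f₂.isAngle fun α hα => ?_, f₃.isAngle fun α hα => ?_, a0, b1, by simp, ?_, ?_⟩
    · exact ⟨by linarith [(ang₁ α hα).1], (ang₁ α hα).2⟩
    · exact ⟨by linarith [(ang₂ α hα).1], by linarith [(ang₂ α hα).2]⟩
    · have := pi_div_two_sub_arctan_mem (σ * α / A)
      exact ⟨by linarith [this.1], this.2.le⟩
    · simp only [a1, htb, mul_one]
      ring
    · simp only [b0, hx₂, mul_one]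
      ring
  · change c₁.meanCurv 1 = c₂.meanCurv 0
    rw [f₁.meanCurv_eq m1, f₂.meanCurv_eq m0]
  · change dα c₁.meanCurv 1 / c₁.speed 1 = dα c₂.meanCurv 0 / c₂.speed 0
    rw [f₁.dα_meanCurv m1, f₂.dα_meanCurv m0, zero_div, zero_div]
  · change 0 < c₁.r α
    rw [hR₁]
    exact nodR_pos hl ha _
  · change 0 < c₂.r α
    rw [hR₂]
    exact nodR_pos hl one_pos _
  · change c₂.r α < 1
    rw [hR₂]
    conv_rhs => rw [← nodR_zero hl one_pos]
    refine nodR_lt_of_sin_lt hl one_pos ?_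
    rw [sin_zero]
    have h1 : 0 < θ₂ α := b1 ▸ anti₂ hα.2
    exact sin_pos_of_pos_of_lt_pi h1 (by linarith [(ang₂ α (Ico_subset_Icc_self hα)).2])
  · change 0 < c₁.z α
    rcases hα.2.lt_or_eq with h | h
    · rcases lt_or_ge (θ₁ α) 0 with h0 | h0
      · exact hzpos.trans (zpos₁ α ⟨hα.1.le, h⟩ h0)
      · have h1 : θ₁ α < π := a0 ▸ anti₁ hα.1
        have := nodZ_strictAntiOn hl ha ⟨h0, h1.le⟩ ⟨hπ.le, le_rfl⟩ h1
        rw [hZ₁]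
        linarith
    · rw [h, z1one]
      exact hzpos
  · change 0 < c₂.z α
    have h1 := ang₂ α hα
    have := (nodZ_strictAntiOn hl one_pos).antitoneOn ⟨h1.1, by linarith⟩
      ⟨hx₂0.le, by linarith⟩ h1.2
    rw [hZ₂]
    linarith
  · refine Subset.antisymm ?_ ?_
    · rintro _ ⟨⟨α, hα, rfl⟩, ⟨α', hα', h⟩⟩
      have hr : c₂.r α' = c₁.r α := (Prod.mk.inj h).1
      rcases hα.2.lt_or_eq with h1 | h1
      · linarith [lt₁ α ⟨hα.1, h1⟩, le₂ α' hα']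
      · rw [h1]
        exact p1
    · rintro _ rfl
      exact ⟨⟨1, m1, p1⟩, ⟨0, m0, rfl⟩⟩
  · refine Subset.antisymm ?_ ?_
    · rintro _ ⟨⟨α, hα, rfl⟩, ⟨α', hα', h⟩⟩
      have hr : (catenary A σ).r α' = c₁.r α := (Prod.mk.inj h).1
      have hz' : (catenary A σ).z α' = c₁.z α := (Prod.mk.inj h).2
      -- Before the junction, Γ₁ is above `zbar` while θ₁ < 0, hence above Γ₃; while θ₁ ≥ 0 its
      -- radius is at most a < A, hence below every radius of Γ₃.
      rcases hα.2.lt_or_eq with h1 | h1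
      · exfalso
        rcases lt_or_ge (θ₁ α) 0 with h0 | h0
        · have h2 := zpos₁ α ⟨hα.1, h1⟩ h0
          have h3 := hz3mono.monotone hα'.2
          rw [hzb] at h3
          linarith
        · have h2 : c₁.r α ≤ a := by
            rw [hR₁]
            conv_rhs => rw [← nodR_zero hl ha]
            refine nodR_le_of_sin_le hl ha ?_
            rw [sin_zero]
            exact sin_nonneg_of_nonneg_of_le_pi h0 (ang₁ α hα).2
          linarith [ge₃ α' hα']
      · rw [h1]
        exact p1
    · rintro _ rfl
      exact ⟨⟨1, m1, p1⟩, ⟨1, m1, p3⟩⟩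
  · refine Subset.antisymm ?_ ?_
    · rintro _ ⟨⟨α, hα, rfl⟩, ⟨α', hα', h⟩⟩
      have hr : (catenary A σ).r α' = c₂.r α := (Prod.mk.inj h).1
      rcases hα.1.lt_or_eq with h1 | h1
      · linarith [lt₂ α ⟨h1, hα.2⟩, le₃ α' hα']
      · rw [← h1]
        rfl
    · rintro _ rfl
      exact ⟨⟨0, m0, rfl⟩, ⟨1, m1, p3⟩⟩

end TwoGrain

namespace TwoGrain

open Set Real MeridianCurve

open scoped ContDiff Topology

/-! ### Smooth dependence of integrals on parameters -/

/-- Induction on n by differentiating under the integral, with the domination supplied by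
compactness. The derivative takes values in `E →L[ℝ] F`, so F must vary in the induction. -/
theorem contDiff_parametric_integral {E : Type} [NormedAddCommGroup E] [NormedSpace ℝ E]
    [ProperSpace E] (n : ℕ) : ∀ {F : Type} [NormedAddCommGroup F] [NormedSpace ℝ F]
    [CompleteSpace F] {f : E → ℝ → F}, ContDiff ℝ n (Function.uncurry f) →
    ContDiff ℝ n fun x => ∫ t in (0 : ℝ)..1, f x t := by
  induction n with
  | zero =>
    intro F _ _ _ f hf
    rw [Nat.cast_zero, contDiff_zero] at *
    exact intervalIntegral.continuous_parametric_intervalIntegral_of_continuous' hf _ _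
  | succ n ih =>
    intro F _ _ _ f hf
    let f' : E → ℝ → E →L[ℝ] F := fun x t =>
      (fderiv ℝ (Function.uncurry f) (x, t)).comp (ContinuousLinearMap.inl ℝ E ℝ)
    have hf1 := contDiff_succ_iff_fderiv.1 (by exact_mod_cast hf : ContDiff ℝ ((n : ℕ∞) + 1) _)
    have hf' : ContDiff ℝ n (Function.uncurry f') := hf1.2.2.clm_comp contDiff_const
    have hd : ∀ x t, HasFDerivAt (fun x => f x t) (f' x t) x := fun x t =>
      HasFDerivAt.comp (g := Function.uncurry f) x (hf1.1 (x, t)).hasFDerivAt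
        (hasFDerivAt_prodMk_left (𝕜 := ℝ) x t)
    have hI : ∀ x, HasFDerivAt (fun x => ∫ t in (0 : ℝ)..1, f x t)
        (∫ t in (0 : ℝ)..1, f' x t) x := fun x => by
      obtain ⟨C, hC⟩ := ((isCompact_closedBall x 1).prod
        (isCompact_Icc (a := (0 : ℝ)) (b := 1))).exists_bound_of_continuousOn
        hf'.continuous.continuousOn
      refine intervalIntegral.hasFDerivAt_integral_of_dominated_of_fderiv_le
        (bound := fun _ => C) (Metric.closedBall_mem_nhds x one_pos)
        (Filter.Eventually.of_forall fun y => ?_) ?_ ?_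
        (Filter.Eventually.of_forall fun t ht y hy => ?_) intervalIntegrable_const
        (Filter.Eventually.of_forall fun t _ y _ => hd y t)
      · exact (hf.continuous.uncurry_left y).aestronglyMeasurable
      · exact (hf.continuous.uncurry_left x).intervalIntegrable _ _
      · exact (hf'.continuous.uncurry_left x).aestronglyMeasurable
      · rw [uIoc_of_le zero_le_one] at ht
        exact hC (y, t) ⟨hy, Ioc_subset_Icc_self ht⟩
    rw [Nat.cast_succ]
    refine contDiff_succ_iff_fderiv.2 ⟨fun x => (hI x).differentiableAt, by simp, ?_⟩
    rw [funext fun x => (hI x).fderiv]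
    exact ih hf'

/-! ### The closing condition -/

noncomputable section

/-- `∫_x^π sin² t / √(1 + u² sin² t) dt`. -/
def sinInt (u x : ℝ) : ℝ := ∫ t in x..π, sin t ^ 2 / √(1 + u ^ 2 * sin t ^ 2)

/-- An affine substitution onto [0, 1] moves the variable lower limit into the integrand. -/
theorem contDiff_sinInt (n : ℕ) : ContDiff ℝ n fun p : ℝ × ℝ => sinInt p.1 p.2 := by
  have h1 : ∀ p : ℝ × ℝ, sinInt p.1 p.2 = (π - p.2) *
      ∫ t in (0 : ℝ)..1, sin ((π - p.2) * t + p.2) ^ 2 /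
        √(1 + p.1 ^ 2 * sin ((π - p.2) * t + p.2) ^ 2) := fun p => by
    have := intervalIntegral.mul_integral_comp_mul_add (a := 0) (b := 1)
      (f := fun t => sin t ^ 2 / √(1 + p.1 ^ 2 * sin t ^ 2)) (π - p.2) p.2
    rw [this, sinInt]
    simp
  rw [funext h1]
  refine (contDiff_const.sub contDiff_snd).mul (contDiff_parametric_integral n ?_)
  refine ContDiff.div (by fun_prop) (ContDiff.sqrt (by fun_prop) fun q => ?_) fun q => ?_
  · positivity
  · positivity

/-- The cofactor of `1 - A² - σ²` in the closing condition. -/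
def closingFactor (β : ℝ) (p : ℝ × ℝ) : ℝ :=
  let u := (1 - p.1 ^ 2 - p.2 ^ 2) / √(4 * (p.1 * cos β + p.2 * sin β) *
    ((2 * p.1 ^ 2 + 2 * p.2 ^ 2 - 1) * p.1 * cos β + p.2 * sin β))
  let x := π / 2 - arctan (p.2 / p.1) - β
  u * sinInt u x - (1 + cos x)

/-- A function, smooth near `(1, 0)`, whose zeros in `Ω₀` are those of `z₁ A σ β π`. -/
def closing (β : ℝ) (p : ℝ × ℝ) : ℝ :=
  -2 * (p.1 * cos β + p.2 * sin β) * (p.1 * arsinh (p.2 / p.1)) +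
    (1 - p.1 ^ 2 - p.2 ^ 2) * closingFactor β p

end

/-- With D = 1 − A² − σ² the multiplier is −2 l D, which clears the prefactor 1/l, while D, the
vanishing denominator of `lam`, becomes a factor of the integral. -/
theorem z₁_pi_mul {A σ β : ℝ} (hmem : (A, σ) ∈ Ω₀) (hneg : A * cos β + σ * sin β < 0)
    (hneg' : (2 * A ^ 2 + 2 * σ ^ 2 - 1) * A * cos β + σ * sin β < 0) :
    -2 * (A * cos β + σ * sin β) * z₁ A σ β π = closing β (A, σ) := by
  have hA : 0 < A := hmem.1
  have hσ : 0 < σ := hmem.2.2.1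
  have hD : 0 < 1 - A ^ 2 - σ ^ 2 := by
    have := (lt_sqrt hσ.le).1 hmem.2.2.2
    linarith
  have hlD : lam A σ β * (1 - A ^ 2 - σ ^ 2) = A * cos β + σ * sin β := by
    rw [lam, div_mul_cancel₀ _ hD.ne']
  have hl : lam A σ β < 0 := div_neg_of_neg_of_pos hneg hD
  have hasq : aell A σ β ^ 2 * (A * cos β + σ * sin β)
      = (2 * A ^ 2 + 2 * σ ^ 2 - 1) * A * cos β + σ * sin β := by
    rw [aell, sq_sqrt (div_pos_of_neg_of_neg hneg' hneg).le, div_mul_cancel₀ _ hneg.ne]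
  have ha : 0 < aell A σ β := sqrt_pos.2 (div_pos_of_neg_of_neg hneg' hneg)
  rw [z₁, zbar_eq hA hσ.le, thetabar₁_eq hA hσ.le, closing, closingFactor]
  dsimp only
  rw [← hasq]
  generalize π / 2 - arctan (σ / A) - β = x
  generalize lam A σ β = l at *
  generalize aell A σ β = a at *
  rw [← hlD]
  generalize 1 - A ^ 2 - σ ^ 2 = D at *
  -- So u is 1/(2|l|a). Pulling 2|l|a out of the square root rewrites the integrand in terms of u,
  -- which tends to 0 at the corner although l tends to −∞.
  have hu : D / √(4 * (l * D) * (a ^ 2 * (l * D))) = 1 / (-2 * l * a) := by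
    rw [show 4 * (l * D) * (a ^ 2 * (l * D)) = (-2 * l * a * D) ^ 2 by ring,
      sqrt_sq (by nlinarith [mul_pos ha hD])]
    have := hl.ne
    field_simp
  rw [hu]
  have hu0 : 0 < 1 / (-2 * l * a) := one_div_pos.2 (by nlinarith)
  have hua : (1 / (-2 * l * a)) * (-2 * l * a) = 1 := one_div_mul_cancel (by nlinarith)
  generalize 1 / (-2 * l * a) = u at *
  have hint : (∫ t in x..π, (sin t ^ 2 / √(sin t ^ 2 + 4 * l ^ 2 * a ^ 2) - sin t))
      = u * sinInt u x - (1 + cos x) := by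
    have hc : Continuous fun t => sin t ^ 2 / √(sin t ^ 2 + 4 * l ^ 2 * a ^ 2) :=
      ((continuous_sin.pow 2).div₀ (contDiff_nodS hl ha).continuous
        fun t => (nodS_pos hl ha t).ne')
    rw [intervalIntegral.integral_sub (hc.intervalIntegrable _ _)
      (continuous_sin.intervalIntegrable _ _), integral_sin, cos_pi, sinInt,
      ← intervalIntegral.integral_const_mul]
    have : ∀ t, sin t ^ 2 / √(sin t ^ 2 + 4 * l ^ 2 * a ^ 2)
        = u * (sin t ^ 2 / √(1 + u ^ 2 * sin t ^ 2)) := fun t => by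
      have hS := nodS_pos hl ha t
      rw [nodS] at hS
      have h1 : 1 + u ^ 2 * sin t ^ 2 = u ^ 2 * (sin t ^ 2 + 4 * l ^ 2 * a ^ 2) := by
        linear_combination (-(u * (-2 * l * a)) - 1) * hua
      rw [h1, sqrt_mul (by positivity), sqrt_sq hu0.le]
      field_simp
    simp only [this]
    ring
  rw [hint]
  have := hl.ne
  field_simp
  ring

/-! ### The implicit function of the closing condition at the corner -/

section Smoothness

variable {β : ℝ}

theorem cos_neg_of_mem (hβ : β ∈ Ioo (π / 2) π) : cos β < 0 :=
  cos_neg_of_pi_div_two_lt_of_lt hβ.1 (by linarith [hβ.2, pi_pos])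

theorem sin_pos_of_mem (hβ : β ∈ Ioo (π / 2) π) : 0 < sin β :=
  sin_pos_of_pos_of_lt_pi (by linarith [hβ.1, pi_pos]) hβ.2

theorem closingFactor_one_zero (β : ℝ) : closingFactor β (1, 0) = -(1 + sin β) := by
  simp [closingFactor, cos_pi_div_two_sub]

theorem contDiffAt_closingFactor (hβ : β ∈ Ioo (π / 2) π) :
    ContDiffAt ℝ 2 (closingFactor β) (1, 0) := by
  have hc := cos_neg_of_mem hβ
  have hx : ContDiffAt ℝ 2 (fun p : ℝ × ℝ => π / 2 - arctan (p.2 / p.1) - β) (1, 0) := by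
    refine ((contDiffAt_const.sub (ContDiffAt.arctan ?_))).sub contDiffAt_const
    exact contDiffAt_snd.div contDiffAt_fst (by norm_num)
  have hu : ContDiffAt ℝ 2 (fun p : ℝ × ℝ => (1 - p.1 ^ 2 - p.2 ^ 2) /
      √(4 * (p.1 * cos β + p.2 * sin β) *
        ((2 * p.1 ^ 2 + 2 * p.2 ^ 2 - 1) * p.1 * cos β + p.2 * sin β))) (1, 0) := by
    -- At (1, 0) the radicand is 4 cos² β, so the square root is smooth there.
    have h0 : 0 < 4 * ((1 : ℝ) * cos β + 0 * sin β) *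
        ((2 * 1 ^ 2 + 2 * 0 ^ 2 - 1) * 1 * cos β + 0 * sin β) := by
      norm_num
      nlinarith
    refine ContDiffAt.div (by fun_prop) (ContDiffAt.sqrt (by fun_prop) h0.ne') ?_
    exact (sqrt_pos.2 h0).ne'
  have hK := (contDiff_sinInt 2).contDiffAt.comp (1, 0) (hu.prodMk hx)
  exact (hu.mul hK).sub (contDiffAt_const.add (contDiff_cos.contDiffAt.comp _ hx))

theorem contDiffAt_closing (hβ : β ∈ Ioo (π / 2) π) : ContDiffAt ℝ 2 (closing β) (1, 0) := by
  have hY : ContDiffAt ℝ 2 (fun p : ℝ × ℝ => arsinh (p.2 / p.1)) (1, 0) :=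
    ContDiffAt.arsinh (contDiffAt_snd.div contDiffAt_fst (by norm_num))
  have hX := contDiffAt_closingFactor hβ
  unfold closing
  fun_prop

theorem closing_one_zero (β : ℝ) : closing β (1, 0) = 0 := by simp [closing]

/-- On the line σ = 0 the arsinh term vanishes; what remains is (1 − t²) times the cofactor, whose
value at the corner is −(1 + sin β) because u = 0 there. -/
theorem fderiv_closing_fst (hβ : β ∈ Ioo (π / 2) π) :
    fderiv ℝ (closing β) (1, 0) (1, 0) = 2 * (1 + sin β) := by
  have hline : HasDerivAt (fun t : ℝ => (t, (0 : ℝ))) (1, 0) 1 :=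
    (hasDerivAt_id 1).prodMk (hasDerivAt_const 1 0)
  have h1 := ((contDiffAt_closing hβ).differentiableAt two_ne_zero).hasFDerivAt.comp_hasDerivAt
    (1 : ℝ) hline
  have hX := ((contDiffAt_closingFactor hβ).differentiableAt
    two_ne_zero).hasFDerivAt.comp_hasDerivAt (1 : ℝ) hline
  have h2 := (((hasDerivAt_id (1 : ℝ)).fun_pow 2).const_sub 1).fun_mul hX
  have h3 : closing β ∘ (fun t : ℝ => (t, (0 : ℝ))) =
      fun t => (1 - t ^ 2) * (closingFactor β ∘ fun t : ℝ => (t, (0 : ℝ))) t := by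
    ext t
    simp [closing]
  rw [h3] at h1
  rw [h1.unique h2]
  simp [closingFactor_one_zero]
  ring

/-- On the line A = 1 the cofactor is multiplied by −t² and drops out to first order; only the
height of the junction contributes. -/
theorem fderiv_closing_snd (hβ : β ∈ Ioo (π / 2) π) :
    fderiv ℝ (closing β) (1, 0) (0, 1) = -2 * cos β := by
  have hline : HasDerivAt (fun t : ℝ => ((1 : ℝ), t)) (0, 1) 0 :=
    (hasDerivAt_const 0 1).prodMk (hasDerivAt_id 0)
  have h1 := ((contDiffAt_closing hβ).differentiableAt two_ne_zero).hasFDerivAt.comp_hasDerivAt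
    (0 : ℝ) hline
  have hX := ((contDiffAt_closingFactor hβ).differentiableAt
    two_ne_zero).hasFDerivAt.comp_hasDerivAt (0 : ℝ) hline
  have h2 := ((((hasDerivAt_id (0 : ℝ)).mul_const (sin β)).const_add (cos β)).const_mul
    (-2)).fun_mul (hasDerivAt_arsinh 0) |>.fun_add
    ((((hasDerivAt_id (0 : ℝ)).fun_pow 2).const_sub 0).fun_mul hX)
  have h3 : closing β ∘ (fun t : ℝ => ((1 : ℝ), t)) =
      fun t => -2 * (cos β + t * sin β) * arsinh t +
        (0 - t ^ 2) * (closingFactor β ∘ fun t : ℝ => ((1 : ℝ), t)) t := by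
    ext t
    simp [closing]
  rw [h3] at h1
  rw [h1.unique h2]
  simp

/-- Second order Taylor bound at a point. -/
theorem isBigO_sub_sub_deriv_mul {f : ℝ → ℝ} {x : ℝ} (hf : ContDiffAt ℝ 2 f x) :
    (fun y => f y - f x - deriv f x * (y - x)) =O[𝓝 x] fun y => (y - x) ^ 2 := by
  have hd : DifferentiableAt ℝ (deriv f) x := by
    have h1 : ContDiffAt ℝ 1 (fderiv ℝ f) x := hf.fderiv_right (by norm_num)
    exact (h1.differentiableAt one_ne_zero).clm_apply (differentiableAt_const (1 : ℝ))
  obtain ⟨C, hC⟩ := hd.isBigO_sub.bound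
  have hdiff : ∀ᶠ y in 𝓝 x, DifferentiableAt ℝ f y :=
    (hf.eventually (by simp)).mono fun y hy => hy.differentiableAt two_ne_zero
  obtain ⟨δ, hδ, hball⟩ := Metric.eventually_nhds_iff_ball.1 (hC.and hdiff)
  refine Asymptotics.IsBigO.of_bound C ?_
  filter_upwards [Metric.ball_mem_nhds x hδ] with y hy
  have hsub : ∀ w ∈ Metric.closedBall x (dist y x), w ∈ Metric.ball x δ := fun w hw =>
    (Metric.mem_closedBall.1 hw).trans_lt hy
  have hC0 : 0 ≤ C * dist y x := by
    have := (hball y hy).1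
    rw [Real.norm_eq_abs (y - x), ← Real.dist_eq] at this
    exact (norm_nonneg _).trans this
  -- Mean value inequality for f w − f'(x) w on the ball of radius |y − x|, where its derivative is
  -- at most C |y − x|.
  have key := Convex.norm_image_sub_le_of_norm_hasDerivWithin_le
    (f := fun w => f w - deriv f x * w) (f' := fun w => deriv f w - deriv f x)
    (C := C * dist y x) (s := Metric.closedBall x (dist y x)) (x := x) (y := y)
    (fun w hw => ?_) (fun w hw => ?_) (convex_closedBall x _)
    (Metric.mem_closedBall_self dist_nonneg) (Metric.mem_closedBall.2 le_rfl)
  · rw [show f y - f x - deriv f x * (y - x) = f y - deriv f x * y - (f x - deriv f x * x) by ring]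
    refine key.trans_eq ?_
    rw [norm_pow, Real.norm_eq_abs, Real.dist_eq]
    ring
  · have := (hball w (hsub w hw)).2.hasDerivAt.fun_sub ((hasDerivAt_id w).const_mul (deriv f x))
    simpa using this.hasDerivWithinAt
  · rcases eq_or_ne y x with rfl | hne
    · have hw' : w = y := by simpa using hw
      simp [hw']
    · have h1 := (hball w (hsub w hw)).1
      have hpos : 0 < dist y x := dist_pos.2 hne
      have hC1 : 0 ≤ C := nonneg_of_mul_nonneg_left hC0 hpos
      rw [Real.norm_eq_abs (w - x), ← Real.dist_eq] at h1
      exact h1.trans (mul_le_mul_of_nonneg_left hw hC1)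

/-- The implicit function of the closing condition at `(1, 0)`. -/
theorem exists_closing_curve (hβ : β ∈ Ioo (π / 2) π) :
    ∃ σ : ℝ → ℝ, ContDiffAt ℝ 2 σ 1 ∧ σ 1 = 0 ∧
      (∀ᶠ p in 𝓝 ((1, 0) : ℝ × ℝ), closing β p = 0 ↔ σ p.1 = p.2) ∧
      HasDerivAt σ (-((1 + sin β) / (-cos β))) 1 := by
  have hc := cos_neg_of_mem hβ
  have hF := contDiffAt_closing hβ
  have hinv : (fderiv ℝ (closing β) (1, 0) ∘L .inr ℝ ℝ ℝ).IsInvertible := by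
    refine ⟨ContinuousLinearEquiv.unitsEquivAut ℝ
      (Units.mk0 (-2 * cos β) (by nlinarith)), ?_⟩
    ext
    simp [fderiv_closing_snd hβ]
  let σ := hF.implicitFunction two_ne_zero hinv
  have hs : ContDiffAt ℝ 2 σ 1 := hF.contDiffAt_implicitFunction two_ne_zero hinv
  have h0 : σ 1 = 0 := hF.implicitFunction_apply_self two_ne_zero hinv
  have hd := (hs.differentiableAt two_ne_zero).hasDerivAt
  refine ⟨σ, hs, h0, ?_, ?_⟩
  · have := hF.eventually_apply_eq_iff_implicitFunction two_ne_zero hinv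
    rwa [closing_one_zero] at this
  · have hzero : (closing β ∘ fun t => (t, σ t)) =ᶠ[𝓝 1] fun _ => 0 := by
      have := hF.eventually_apply_implicitFunction two_ne_zero hinv
      rw [closing_one_zero] at this
      exact this
    have hFd : HasFDerivAt (closing β) (fderiv ℝ (closing β) (1, 0)) (1, σ 1) := by
      rw [h0]
      exact (hF.differentiableAt two_ne_zero).hasFDerivAt
    have h1 := hFd.comp_hasDerivAt (1 : ℝ) ((hasDerivAt_id (1 : ℝ)).prodMk hd)
    have h2 := h1.unique ((hasDerivAt_const (1 : ℝ) (0 : ℝ)).congr_of_eventuallyEq hzero)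
    have h3 : ((1 : ℝ), deriv σ 1) = (1, 0) + deriv σ 1 • ((0 : ℝ), (1 : ℝ)) := by simp
    rw [h3, map_add, map_smul, fderiv_closing_fst hβ, fderiv_closing_snd hβ, smul_eq_mul] at h2
    have h4 : deriv σ 1 = -((1 + sin β) / (-cos β)) := by
      rw [← neg_div, eq_div_iff (by linarith)]
      linarith
    rwa [h4] at hd

end Smoothness

end TwoGrain

namespace TwoGrain

open Set Real MeridianCurve

open scoped Topology

/-! ### Parameters near `(1, 0)` -/

/-- The open conditions on the parameters which hold near `(1, 0)`. -/
structure NearCorner (β : ℝ) (p : ℝ × ℝ) : Prop where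
  neg : p.1 * cos β + p.2 * sin β < 0
  neg' : (2 * p.1 ^ 2 + 2 * p.2 ^ 2 - 1) * p.1 * cos β + p.2 * sin β < 0
  tan_gt : p.1 * (1 - 2 * p.1 ^ 2 - 2 * p.2 ^ 2) < Real.tan β * p.2
  cos_gt : -(p.1 / √(p.2 ^ 2 + p.1 ^ 2)) < cos β
  arctan_lt : arctan (p.2 / p.1) < β - π / 2
  arctan_lt' : arctan (p.2 / p.1) < π - β

/-- Each condition is a strict inequality between functions continuous at (1, 0) and holds there.
The tangent condition is multiplied through by σ for this reason. -/
theorem eventually_nearCorner {β : ℝ} (hβ : β ∈ Ioo (π / 2) π) :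
    ∀ᶠ p in 𝓝 ((1, 0) : ℝ × ℝ), NearCorner β p := by
  have hc := cos_neg_of_mem hβ
  have hc1 : -1 < cos β := by
    rw [← cos_pi]
    exact cos_lt_cos_of_nonneg_of_le_pi (by linarith [hβ.1, pi_pos]) le_rfl hβ.2
  have hat : ContinuousAt (fun p : ℝ × ℝ => arctan (p.2 / p.1)) (1, 0) :=
    continuous_arctan.continuousAt.comp
      (continuousAt_snd.div (g := Prod.fst) continuousAt_fst one_ne_zero)
  have h1 : ∀ᶠ p in 𝓝 ((1, 0) : ℝ × ℝ), p.1 * cos β + p.2 * sin β < 0 :=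
    ContinuousAt.eventually_lt (by fun_prop) (by fun_prop) (by simpa using hc)
  have h2 : ∀ᶠ p in 𝓝 ((1, 0) : ℝ × ℝ),
      (2 * p.1 ^ 2 + 2 * p.2 ^ 2 - 1) * p.1 * cos β + p.2 * sin β < 0 :=
    ContinuousAt.eventually_lt (by fun_prop) (by fun_prop) (by norm_num; exact hc)
  have h3 : ∀ᶠ p in 𝓝 ((1, 0) : ℝ × ℝ),
      p.1 * (1 - 2 * p.1 ^ 2 - 2 * p.2 ^ 2) < Real.tan β * p.2 :=
    ContinuousAt.eventually_lt (by fun_prop) (by fun_prop) (by norm_num)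
  have h4 : ∀ᶠ p in 𝓝 ((1, 0) : ℝ × ℝ), -(p.1 / √(p.2 ^ 2 + p.1 ^ 2)) < cos β := by
    refine ContinuousAt.eventually_lt ?_ continuousAt_const (by simpa using hc1)
    exact (continuousAt_fst.div (by fun_prop) (by norm_num)).neg
  have h5 : ∀ᶠ p in 𝓝 ((1, 0) : ℝ × ℝ), arctan (p.2 / p.1) < β - π / 2 :=
    hat.eventually_lt continuousAt_const (by simpa using hβ.1)
  have h6 : ∀ᶠ p in 𝓝 ((1, 0) : ℝ × ℝ), arctan (p.2 / p.1) < π - β :=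
    hat.eventually_lt continuousAt_const (by simpa using hβ.2)
  filter_upwards [h1, h2, h3, h4, h5, h6] with p a1 a2 a3 a4 a5 a6
  exact ⟨a1, a2, a3, a4, a5, a6⟩

/-- The sets `Ωnear ε` shrink to `(1, 0)`. -/
theorem exists_Ωnear_subset {s : Set (ℝ × ℝ)} (hs : s ∈ 𝓝 ((1, 0) : ℝ × ℝ)) :
    ∃ ε > 0, Ωnear ε ⊆ s := by
  obtain ⟨δ, hδ, hball⟩ := Metric.mem_nhds_iff.1 hs
  -- In `Ω₀`, σ² < 1 − A² < 2(1 − A) < 2ε, so ε ≤ δ²/2 yields σ < δ.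
  refine ⟨min δ (δ ^ 2 / 2), by positivity, fun p hp => hball ?_⟩
  obtain ⟨⟨h1, h2, h3, h4⟩, h5⟩ := hp
  have h6 := min_le_left δ (δ ^ 2 / 2)
  have h7 := min_le_right δ (δ ^ 2 / 2)
  have h8 := (lt_sqrt h3.le).1 h4
  rw [Metric.mem_ball, Prod.dist_eq, max_lt_iff, Real.dist_eq, Real.dist_eq, abs_lt, abs_lt]
  refine ⟨⟨by linarith, by linarith⟩, by linarith, ?_⟩
  rw [sub_zero]
  exact lt_of_pow_lt_pow_left₀ 2 hδ.le (by nlinarith)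

theorem mem_Ω₀_of_sq_lt {A σ : ℝ} (h0 : 0 < A) (h1 : A < 1) (hσ : 0 < σ)
    (h : 2 * σ ^ 2 < 1 - A ^ 2) : (A, σ) ∈ Ω₀ :=
  ⟨h0, h1, hσ, lt_sqrt_of_sq_lt (by nlinarith)⟩

/-- After clearing the negative denominator the claim is A(−cos β)(1 − A² − 2σ²) + σ sin β (1 − A²)
> 0, a sum of positive terms. It is equivalent to the admissibility condition `tan_lt`. -/
theorem aell_lt {A σ β : ℝ} (hβ : β ∈ Ioo (π / 2) π) (h0 : 0 < A) (hσ : 0 < σ)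
    (h : 2 * σ ^ 2 < 1 - A ^ 2) (hneg : A * cos β + σ * sin β < 0) : aell A σ β < A := by
  have hc := cos_neg_of_mem hβ
  have hs := sin_pos_of_mem hβ
  rw [aell, sqrt_lt' h0, div_lt_iff_of_neg hneg]
  have h2 : 0 < A * -cos β * (1 - A ^ 2 - 2 * σ ^ 2) :=
    mul_pos (mul_pos h0 (by linarith)) (by linarith)
  have h3 : 0 < σ * sin β * (1 - A ^ 2) := mul_pos (mul_pos hσ hs) (by nlinarith)
  linarith

/-- Near the corner the implication `cos_lt` is vacuous, and `tan_lt` compares a negative number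
with a nonnegative one. -/
theorem admissible_of_nearCorner {A σ β : ℝ} (hβ : β ∈ Ioo (π / 2) π) (h0 : 0 < A) (h1 : A < 1)
    (hσ : 0 < σ) (h : 2 * σ ^ 2 < 1 - A ^ 2) (hnear : NearCorner β (A, σ))
    (hz : z₁ A σ β π = 0) : Admissible A σ β where
  mem_Ω₀ := mem_Ω₀_of_sq_lt h0 h1 hσ h
  beta_mem := hβ
  tan_gt := by
    rw [div_mul_eq_mul_div, div_lt_iff₀ hσ]
    exact hnear.tan_gt
  cos_lt := fun hcon => absurd hcon hnear.cos_gt.not_gt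
  z₁_pi_nonpos := hz.le
  tan_lt := by
    have ht : Real.tan β < 0 := by
      rw [tan_eq_sin_div_cos]
      exact div_neg_of_pos_of_neg (sin_pos_of_mem hβ) (cos_neg_of_mem hβ)
    have h2 : 0 ≤ 1 - A ^ 2 - 2 * σ ^ 2 := by linarith
    have h3 : 0 < 1 - A ^ 2 := by nlinarith
    exact ht.trans_le (by positivity)

/-- A differentiable curve leaving `(1, 0)` to the upper left with finite slope enters `Ω₀`. -/
theorem eventually_pos_and_sq_lt {σ : ℝ → ℝ} {k : ℝ} (hk : 0 < k) (h1 : σ 1 = 0)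
    (hd : HasDerivAt σ (-k) 1) : ∀ᶠ A in 𝓝[<] (1 : ℝ), 0 < σ A ∧ 2 * σ A ^ 2 < 1 - A ^ 2 := by
  have hlo := (hasDerivAt_iff_isLittleO.1 hd).bound (half_pos hk)
  have hsmall : ∀ᶠ A in 𝓝 (1 : ℝ), 8 * k ^ 2 * (1 - A) < 1 :=
    -- The little-o bound yields σ ≤ 2k(1 − A), so 2σ² ≤ 8k²(1 − A)²; this threshold makes that less
    -- than 1 − A < 1 − A².
    ContinuousAt.eventually_lt (by fun_prop) (by fun_prop) (by norm_num)
  have hpos : ∀ᶠ A in 𝓝 (1 : ℝ), (0 : ℝ) < A := eventually_gt_nhds one_pos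
  filter_upwards [nhdsWithin_le_nhds hlo, nhdsWithin_le_nhds hsmall, nhdsWithin_le_nhds hpos,
    self_mem_nhdsWithin] with A hA hA2 hA3 hA1
  have hA1' : A < 1 := hA1
  rw [h1, smul_eq_mul, Real.norm_eq_abs, Real.norm_eq_abs, abs_of_neg (show A - 1 < 0 by linarith),
    abs_le] at hA
  have hδ : 0 < k * (1 - A) := mul_pos hk (by linarith)
  have hl : 0 < σ A := by linarith
  have hu : σ A ≤ 2 * (k * (1 - A)) := by linarith
  refine ⟨hl, ?_⟩
  have h3 : σ A ^ 2 ≤ (2 * (k * (1 - A))) ^ 2 := pow_le_pow_left₀ hl.le hu 2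
  have h4 : 8 * k ^ 2 * (1 - A) * (1 - A) < 1 * (1 - A) :=
    mul_lt_mul_of_pos_right hA2 (by linarith)
  nlinarith

end TwoGrain

/-! ### The one-parameter family of steady states -/

open TwoGrain

theorem theorem6p1 (β : ℝ) (hβ : β ∈ Set.Ioo (Real.pi / 2) Real.pi) :
    (∃ ε ∈ Set.Ioo (0 : ℝ) 1, ∃ σ : ℝ → ℝ,
      ContDiffOn ℝ 1 σ (Set.Ioo (1 - ε) 1) ∧
      (∀ A ∈ Set.Ioo (1 - ε) 1,
        (A, σ A) ∈ TwoGrain.Ωnear ε ∧ TwoGrain.Admissible A (σ A) β ∧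
          TwoGrain.z₁ A (σ A) β Real.pi = 0) ∧
      (∀ p ∈ TwoGrain.Ωnear ε,
        (∃ P : TwoGrain.Profile, P.IsSteadyState β Real.pi ∧ P.params = p) ↔ p.2 = σ p.1) ∧
      (∀ P Q : TwoGrain.Profile, P.IsSteadyState β Real.pi → Q.IsSteadyState β Real.pi →
        P.params ∈ TwoGrain.Ωnear ε → P.params = Q.params → P.Same Q) ∧
      Filter.Tendsto σ (nhdsWithin 1 (Set.Iio 1)) (nhds 0) ∧
      Asymptotics.IsBigO (nhdsWithin 1 (Set.Iio 1))
        (fun A => σ A - (1 + Real.sin β) / (-Real.cos β) * (1 - A))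
        (fun A => (1 - A) ^ 2)) ∧
    (∀ P : TwoGrain.Profile, P.IsSteadyState β Real.pi → P.params ∈ TwoGrain.Ω₀) ∧
    Cardinal.mk {p : ℝ × ℝ | ∃ P : TwoGrain.Profile,
      P.IsSteadyState β Real.pi ∧ P.params = p} = Cardinal.continuum := by
  have hc := cos_neg_of_mem hβ
  have hs := sin_pos_of_mem hβ
  obtain ⟨σ, hσ, hσ1, hiff, hd⟩ := exists_closing_curve hβ
  obtain ⟨ε₁, hε₁, hsub⟩ := exists_Ωnear_subset (hiff.and (eventually_nearCorner hβ))
  have hcurve : ∀ᶠ A in nhdsWithin (1 : ℝ) (Set.Iio 1),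
      (0 < σ A ∧ 2 * σ A ^ 2 < 1 - A ^ 2) ∧ ContDiffAt ℝ 2 σ A :=
    (eventually_pos_and_sq_lt (div_pos (by linarith) (by linarith)) hσ1 hd).and
      (nhdsWithin_le_nhds (hσ.eventually (by simp)))
  obtain ⟨b, hb, hIoo⟩ := mem_nhdsLT_iff_exists_Ioo_subset.1 hcurve
  -- Here ε₁ provides the implicit equivalence and the corner inequalities, 1 − b keeps the graph of
  -- σ smooth and inside `Ω₀`, and 1/2 ensures A > 0 and ε < 1.
  set ε := min ε₁ (min (1 - b) (1 / 2)) with hε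
  have hb' : b < 1 := hb
  have hε0 : 0 < ε := lt_min hε₁ (lt_min (by linarith) (by norm_num))
  have hεε₁ : ε ≤ ε₁ := min_le_left _ _
  have hεb : ε ≤ 1 - b := (min_le_right _ _).trans (min_le_left _ _)
  have hε2 : ε ≤ 1 / 2 := (min_le_right _ _).trans (min_le_right _ _)
  have hnear : ∀ p ∈ Ωnear ε, (closing β p = 0 ↔ σ p.1 = p.2) ∧ NearCorner β p :=
    fun p hp => hsub ⟨hp.1, by linarith [hp.2]⟩
  have hA : ∀ A ∈ Set.Ioo (1 - ε) 1,
      (0 < σ A ∧ 2 * σ A ^ 2 < 1 - A ^ 2) ∧ ContDiffAt ℝ 2 σ A := fun A hA =>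
    hIoo ⟨by linarith [hA.1], hA.2⟩
  have hmem : ∀ A ∈ Set.Ioo (1 - ε) 1, (A, σ A) ∈ Ωnear ε := fun A h =>
    ⟨mem_Ω₀_of_sq_lt (by linarith [h.1]) h.2 (hA A h).1.1 (hA A h).1.2, h.1⟩
  have hzero : ∀ p ∈ Ωnear ε, z₁ p.1 p.2 β Real.pi = 0 ↔ σ p.1 = p.2 := fun p hp => by
    obtain ⟨h1, h2⟩ := hnear p hp
    -- The factor −2(A cos β + σ sin β) is positive, so `closing` and z₁(π) have the same zeros.
    rw [← h1, ← z₁_pi_mul hp.1 h2.neg h2.neg', mul_eq_zero]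
    refine ⟨Or.inr, fun h => h.resolve_left ?_⟩
    linarith [h2.neg]
  have hz : ∀ A ∈ Set.Ioo (1 - ε) 1, z₁ A (σ A) β Real.pi = 0 := fun A h =>
    (hzero _ (hmem A h)).2 rfl
  have hex : ∀ A ∈ Set.Ioo (1 - ε) 1,
      ∃ P : Profile, P.IsSteadyState β Real.pi ∧ P.params = (A, σ A) := fun A h => by
    obtain ⟨-, h2⟩ := hnear _ (hmem A h)
    obtain ⟨⟨p1, p2⟩, -⟩ := hA A h
    exact exists_steadyState (hmem A h).1 h2.neg h2.neg' h2.arctan_lt h2.arctan_lt'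
      (aell_lt hβ (by linarith [h.1]) p1 p2 h2.neg) (hz A h)
  refine ⟨⟨ε, ⟨hε0, by linarith⟩, σ, fun A h => ?_, fun A h => ⟨hmem A h, ?_, hz A h⟩,
    fun p hp => ⟨?_, fun h => ?_⟩, ?_, ?_, ?_⟩, fun P hP => hP.params_mem, ?_⟩
  · exact ((hA A h).2.of_le (by norm_num)).contDiffWithinAt
  · exact admissible_of_nearCorner hβ (by linarith [h.1]) h.2 (hA A h).1.1 (hA A h).1.2
      (hnear _ (hmem A h)).2 (hz A h)
  · rintro ⟨P, hP, rfl⟩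
    exact ((hzero _ hp).1 (hP.z₁_pi_eq_zero rfl (hnear _ hp).2.neg)).symm
  · obtain ⟨P, hP, hpar⟩ := hex p.1 ⟨hp.2, hp.1.2.1⟩
    exact ⟨P, hP, hpar.trans (Prod.ext rfl h.symm)⟩
  · intro P Q hP hQ hp hpq
    exact hP.same hQ rfl hpq.symm (hnear _ hp).2.neg
  · have := hσ.continuousAt.tendsto
    rw [hσ1] at this
    exact this.mono_left nhdsWithin_le_nhds
  · have h := (isBigO_sub_sub_deriv_mul hσ).mono (nhdsWithin_le_nhds (s := Set.Iio 1))
    rw [hσ1, hd.deriv] at h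
    refine (h.congr_left fun A => by ring).congr_right fun A => by ring
  · refine le_antisymm ?_ ?_
    · refine (Cardinal.mk_set_le _).trans ?_
      simp [Cardinal.mk_real]
    -- The graph of σ over the interval injects into the parameter set, as A is its first
    -- coordinate.
    · rw [← Cardinal.mk_Ioo_real (show 1 - ε < 1 by linarith)]
      refine Cardinal.mk_le_of_injective (f := fun A => ⟨(A.1, σ A.1), hex A.1 A.2⟩) ?_
      intro A B h
      exact Subtype.ext (congrArg (fun q => q.1.1) h)
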